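/- Consider a non-empty finite set $N$ of agents and a non-empty finite set $M$ of items. Each agent $i\in N$ has an additive valuation $v_i\colon 2^M\to\mathbb{N}_0$, an additive social impact function $s_i\colon 2^M\to\mathbb{N}_0$ and a weight $w_i>0$. An allocation $A=(A_i)_{i\in N}$ is a partition of $M$ into pairwise disjoint, possibly empty, bundles. It is social impact maximizing (SIM) if $\sum_{i\in N} s_i(A_i)\ge\sum_{i\in N} s_i(A'_i)$ for every allocation $A'$. It is - EF1 if for all $i,j\in N$ there is $g\in M$ with $v_i(A_i)\ge v_i(A_j\setminus\{g\})$; - sEF1 if for every $j\in N$ there is $g\in M$ such that $v_i(A_i)\ge v_i(A_j\setminus\{g\})$ for every $i\in N$; - wEF1 if for all $i,j\in N$ there is $g\in M$ with $v_i(A_i)/w_i\ge v_i(A_j\setminus\{g\})/w_j$; - swEF1 if for every $j\in N$ there is $g\in M$ such that $v_i(A_i)/w_i\ge v_i(A_j\setminus\{g\})/w_j$ for every $i\in N$; - EFL if for all $i,j\in N$, either $A_j$ contains at most one item $g$ with $v_i(\{g\})>0$, or there is $g\in A_j$ with $v_i(A_i)\ge v_i(A_j\setminus\{g\})$ and $v_i(A_i)\ge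 v_i(\{g\})$; - tEF1 if for all $i,j\in N$ with $v_i(A_i)<v_i(A_j)$ there is $g\in A_j$ with $v_i(A_i\cup\{g\})\ge v_i(A_j\setminus\{g\})$. **Theorem.** Let $\mathcal F\in\{\mathrm{tEF1},\mathrm{EF1},\mathrm{sEF1},\mathrm{wEF1},\mathrm{swEF1},\mathrm{EFL}\}$. If the valuations are binary, i.e. $v_i(\{g\})\in\{0,1\}$ for all $i\in N$ and $g\in M$, and $v_i=s_i$ for every $i\in N$, then an allocation that is both SIM and $\mathcal F$-fair exists (for arbitrary positive real weights). Moreover, there is a polynomial-time algorithm (a multi-stack Turing machine whose number of steps is bounded by a polynomial in the length of its input) that, given such an instance with positive rational weights, all numbers written in binary, outputs a SIM and $\mathcal F$-fair allocation. -/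

import Mathlib

namespace FairDivision

/-- An instance of fair division with social impact, with set of agents `N` and set of items `M`.
Valuations and social impact functions are additive with values in the natural numbers, so they are
given by the values of single items; see `bundleVal` and `bundleImpact` for bundles. -/
structure SocialImpactInstance (N M : Type*) where
  /-- `val i g` is the value of item `g` for agent `i`. -/
  val : N → M → ℕ
  /-- `impact i g` is the social impact that agent `i` generates with item `g`. -/
  impact : N → M → ℕ

namespace SocialImpactInstance

variable {N M : Type*}

/-- The (additive) valuation of agent `i` for the bundle `S`. -/
def bundleVal (I : SocialImpactInstance N M) (i : N) (S : Finset M) : ℕ :=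
  ∑ g ∈ S, I.val i g

/-- The (additive) social impact of agent `i` with the bundle `S`. -/
def bundleImpact (I : SocialImpactInstance N M) (i : N) (S : Finset M) : ℕ :=
  ∑ g ∈ S, I.impact i g

/-- Every agent values every item at `0` or `1`. -/
def IsBinary (I : SocialImpactInstance N M) : Prop :=
  ∀ i g, I.val i g = 0 ∨ I.val i g = 1

/-- The valuation of every agent equals its social impact function. -/
def ValEqImpact (I : SocialImpactInstance N M) : Prop :=
  ∀ i, I.val i = I.impact i

end SocialImpactInstance

/-- A (complete) allocation: pairwise disjoint, possibly empty, bundles that cover all items. -/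
structure Allocation (N M : Type*) where
  /-- the bundle of each agent -/
  bundle : N → Finset M
  disjoint : ∀ i j, i ≠ j → Disjoint (bundle i) (bundle j)
  cover : ∀ g, ∃ i, g ∈ bundle i

section Notions

variable {N M : Type*}

/-- The overall social impact of an allocation. -/
def socialImpact [Fintype N] (I : SocialImpactInstance N M) (A : Allocation N M) : ℕ :=
  ∑ i, I.bundleImpact i (A.bundle i)

/-- Social impact maximizing allocations. -/
def IsSIM [Fintype N] (I : SocialImpactInstance N M) (A : Allocation N M) : Prop :=
  ∀ A' : Allocation N M, socialImpact I A' ≤ socialImpact I A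

variable [DecidableEq M]

/-- Envy-freeness up to one item. -/
def IsEF1 (I : SocialImpactInstance N M) (A : Allocation N M) : Prop :=
  ∀ i j : N, ∃ g : M, I.bundleVal i (A.bundle j \ {g}) ≤ I.bundleVal i (A.bundle i)

/-- Strong envy-freeness up to one item: the removed item does not depend on the envious agent. -/
def IsSEF1 (I : SocialImpactInstance N M) (A : Allocation N M) : Prop :=
  ∀ j : N, ∃ g : M, ∀ i : N, I.bundleVal i (A.bundle j \ {g}) ≤ I.bundleVal i (A.bundle i)

/-- Weighted envy-freeness up to one item. -/
def IsWEF1 (I : SocialImpactInstance N M) (w : N → ℝ) (A : Allocation N M) : Prop :=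
  ∀ i j : N, ∃ g : M,
    (I.bundleVal i (A.bundle j \ {g}) : ℝ) / w j ≤ (I.bundleVal i (A.bundle i) : ℝ) / w i

/-- Strong weighted envy-freeness up to one item. -/
def IsSWEF1 (I : SocialImpactInstance N M) (w : N → ℝ) (A : Allocation N M) : Prop :=
  ∀ j : N, ∃ g : M, ∀ i : N,
    (I.bundleVal i (A.bundle j \ {g}) : ℝ) / w j ≤ (I.bundleVal i (A.bundle i) : ℝ) / w i

/-- Envy-freeness up to one less preferred item. -/
def IsEFL (I : SocialImpactInstance N M) (A : Allocation N M) : Prop :=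
  ∀ i j : N,
    ((A.bundle j).filter (fun g => 0 < I.val i g)).card ≤ 1 ∨
    ∃ g ∈ A.bundle j,
      I.bundleVal i (A.bundle j \ {g}) ≤ I.bundleVal i (A.bundle i) ∧
      I.bundleVal i {g} ≤ I.bundleVal i (A.bundle i)

/-- Envy-freeness up to one transfer. -/
def IsTEF1 (I : SocialImpactInstance N M) (A : Allocation N M) : Prop :=
  ∀ i j : N, I.bundleVal i (A.bundle i) < I.bundleVal i (A.bundle j) →
    ∃ g ∈ A.bundle j,
      I.bundleVal i (A.bundle j \ {g}) ≤ I.bundleVal i (A.bundle i ∪ {g})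

/-- The six fairness notions. -/
inductive FairnessNotion
  | tEF1
  | EF1
  | sEF1
  | wEF1
  | swEF1
  | EFL

/-- The allocation `A` is `F`-fair; `w` are the weights of the agents, which matter only for the two
weighted notions. -/
def IsFair (F : FairnessNotion) (I : SocialImpactInstance N M) (w : N → ℝ)
    (A : Allocation N M) : Prop :=
  match F with
  | .tEF1 => IsTEF1 I A
  | .EF1 => IsEF1 I A
  | .sEF1 => IsSEF1 I A
  | .wEF1 => IsWEF1 I w A
  | .swEF1 => IsSWEF1 I w A
  | .EFL => IsEFL I A

end Notions

/-! ### The computational problem -/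

/-- Inputs of the computational problem: an instance with at least one agent and at least one item,
together with positive rational weights of the agents. -/
structure Input where
  numAgents : ℕ
  numItems : ℕ
  numAgents_pos : 0 < numAgents
  numItems_pos : 0 < numItems
  inst : SocialImpactInstance (Fin numAgents) (Fin numItems)
  weight : Fin numAgents → ℚ
  weight_pos : ∀ i, 0 < weight i

/-- Inputs with binary valuations that equal the social impact functions. -/
def BinaryEqualInput : Type :=
  {x : Input // x.inst.IsBinary ∧ x.inst.ValEqImpact}

/-- A natural number in binary, followed by a separator. -/
def encodeNumber (k : ℕ) : List Computability.Γ' :=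
  Computability.encodingNatΓ'.encode k ++ [Computability.Γ'.comma]

/-- A positive rational number: numerator and denominator in lowest terms, in binary. -/
def encodePosRat (q : ℚ) : List Computability.Γ' :=
  encodeNumber q.num.natAbs ++ encodeNumber q.den

/-- The whole input as a word: first the list of the weights, then for each item the list of its
value and its social impact for all agents; each list is closed by a `ket`. -/
def encodeInput (x : Input) : List Computability.Γ' :=
  ((List.finRange x.numAgents).flatMap fun i => encodePosRat (x.weight i)) ++
    [Computability.Γ'.ket] ++
    (List.finRange x.numItems).flatMap fun g =>
      ((List.finRange x.numAgents).flatMap fun i =>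
        encodeNumber (x.inst.val i g) ++ encodeNumber (x.inst.impact i g)) ++
      [Computability.Γ'.ket]

/-- An allocation as a word: for each item the list of bits that tell for all agents whether the
item is in the bundle of the agent; each list is closed by a `ket`. -/
def encodeAllocation {n m : ℕ} (A : Allocation (Fin n) (Fin m)) : List Computability.Γ' :=
  (List.finRange m).flatMap fun g =>
    ((List.finRange n).map fun i => Computability.Γ'.bit (decide (g ∈ A.bundle i))) ++
      [Computability.Γ'.ket]

/-- The algorithm `alg`, which returns an allocation for every input with binary valuations that
equal the social impact functions, runs in polynomial time: a Turing machine computes (the encoding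
of) its output from the encoding of the input, in a number of steps that is polynomial in the length
of the latter. -/
def RunsInPolyTime
    (alg : ∀ x : BinaryEqualInput, Allocation (Fin x.1.numAgents) (Fin x.1.numItems)) : Prop :=
  Nonempty (Turing.TM2ComputableInPolyTime
    (fun x : BinaryEqualInput => encodeInput x.1)
    (fun y : List Computability.Γ' => y)
    (fun x => encodeAllocation (alg x)))

end FairDivision

/-! An allocation is a map from items to owners. With binary valuations equal to the impacts, an
item contributes 0 or 1 to the social impact, so a clean assignment is SIM: every item that somebody
likes belongs to somebody who likes it (`isSIM_allocationOf`). Within the clean assignments a local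
search balances the bundles. Let c_i be the number of items that agent i owns and likes. If i likes
an item that its owner j also likes, and c_i / w_i < (c_j - 1) / w_j, the item passes from j to i.
This keeps the assignment clean.

Termination: the items counted by c_i occupy slots with values 0 / w_i, 1 / w_i, ..., (c_i - 1) /
w_i. A transfer replaces the slot value (c_j - 1) / w_j by the smaller c_i / w_i. Replacing slot
values by their ranks among the |N||M| possible slots gives a natural number, at most |N||M|²
whatever the weights are, that falls with every transfer (`potential_update_lt`, `potential_le`). So
a clean assignment without violations exists for all real weights, and the search needs only
polynomially many transfers.

Fairness: in a clean assignment, whatever i likes in the bundle of j is liked by j. After the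
removal of any item that j likes, i therefore likes at most c_j - 1 items there; if i likes at least
one of them, the absence of a violation bounds the weighted envy (`bundleVal_sdiff_le`). This gives
swEF1. The other notions follow, the unweighted ones from all weights being 1
(`isFair_allocationOf`).

Polynomial time: structured programs on four stacks are simulated step by step by stack machines
(`Exec.simulate`). Data are trees, written in prefix order on a stack, and the functions computed in
polynomial time are closed under composition, pairing, case distinction and folds with polynomially
bounded intermediate results. Indices are unary, weights binary. In this calculus the local search
is a fold: |N||M|² sweeps over all pairs of an item and an agent (`Table.Represents.exists_search`).
-/

namespace FairDivision

open Computability Turing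

/-! ### Structured programs for stack machines -/

/-- Structured programs that operate on four stacks over the alphabet `Γ'` and on one variable,
which holds the result of the last `pop`. -/
inductive Prog
  | push (k : Fin 4) (c : Γ')
  | pushVar (k : Fin 4)
  | pop (k : Fin 4)
  | seq (p q : Prog)
  | ite (b : Option Γ' → Bool) (p q : Prog)
  | loop (b : Option Γ' → Bool) (p : Prog)

/-- The contents of the four stacks. -/
abbrev Stacks := Fin 4 → List Γ'

/-- `Exec p v S n v' S'`: started with the variable `v` and the stacks `S`, the program `p` ends
after `n` steps with the variable `v'` and the stacks `S'`. -/
inductive Exec : Prog → Option Γ' → Stacks → ℕ → Option Γ' → Stacks → Prop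
  | push (k c v S) : Exec (.push k c) v S 1 v (Function.update S k (c :: S k))
  | pushVar (k v S) : Exec (.pushVar k) v S 1 v (Function.update S k (v.getD .blank :: S k))
  | pop (k v S) : Exec (.pop k) v S 1 (S k).head? (Function.update S k (S k).tail)
  | seq {p q v S n v' S' m v'' S''} (hp : Exec p v S n v' S') (hq : Exec q v' S' m v'' S'') :
      Exec (.seq p q) v S (n + m) v'' S''
  | iteTrue {b p q v S n v' S'} (hb : b v = true) (hp : Exec p v S n v' S') :
      Exec (.ite b p q) v S (n + 1) v' S'
  | iteFalse {b p q v S n v' S'} (hb : b v = false) (hq : Exec q v S n v' S') :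
      Exec (.ite b p q) v S (n + 1) v' S'
  | loopDone {b p v S} (hb : b v = false) : Exec (.loop b p) v S 1 v S
  | loopStep {b p v S n v' S' m v'' S''} (hb : b v = true) (hp : Exec p v S n v' S')
      (hq : Exec (.loop b p) v' S' m v'' S'') : Exec (.loop b p) v S (n + m + 1) v'' S''

/-- A step lets the total height of the stacks grow by at most one. -/
theorem Exec.height_le {p v S n v' S'} (h : Exec p v S n v' S') :
    ∑ k, (S' k).length ≤ ∑ k, (S k).length + n := by
  have aux : ∀ (S : Stacks) (k : Fin 4) (l : List Γ'), l.length ≤ (S k).length + 1 →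
      ∑ j, (Function.update S k l j).length ≤ ∑ j, (S j).length + 1 := by
    intro S k l hl
    have h1 := Finset.sum_update_of_mem (Finset.mem_univ k) (fun j => (S j).length) l.length
    have h2 := Finset.add_sum_erase Finset.univ (fun j => (S j).length) (Finset.mem_univ k)
    have h3 : (fun j => (Function.update S k l j).length) =
        Function.update (fun j => (S j).length) k l.length := by
      funext j
      by_cases hj : j = k
      · subst hj; simp
      · simp [hj]
    rw [h3, h1, Finset.sdiff_singleton_eq_erase]
    omega
  induction h with
  | push k c v S => exact aux _ _ _ (by simp)
  | pushVar k v S => exact aux _ _ _ (by simp)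
  | pop k v S => exact aux _ _ _ (by simp; omega)
  | seq _ _ ih1 ih2 => omega
  | iteTrue _ _ ih => omega
  | iteFalse _ _ ih => omega
  | loopDone => omega
  | loopStep _ _ _ ih1 ih2 => omega

namespace Prog

/-- The labels of the machine code of a program. -/
def Label : Prog → Type
  | push _ _ => Unit
  | pushVar _ => Unit
  | pop _ => Unit
  | seq p q => p.Label ⊕ q.Label
  | ite _ p q => Unit ⊕ (p.Label ⊕ q.Label)
  | loop _ p => Unit ⊕ p.Label

/-- There are finitely many labels. -/
@[reducible]
def labelFintype : ∀ p : Prog, Fintype p.Label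
  | push _ _ => inferInstanceAs (Fintype Unit)
  | pushVar _ => inferInstanceAs (Fintype Unit)
  | pop _ => inferInstanceAs (Fintype Unit)
  | seq p q => @instFintypeSum _ _ p.labelFintype q.labelFintype
  | ite _ p q =>
    @instFintypeSum Unit _ _ (@instFintypeSum _ _ p.labelFintype q.labelFintype)
  | loop _ p => @instFintypeSum Unit _ _ p.labelFintype

/-- The label at which the machine code of a program starts. -/
def entry : ∀ p : Prog, p.Label
  | push _ _ => ()
  | pushVar _ => ()
  | pop _ => ()
  | seq p _ => Sum.inl p.entry
  | ite _ _ _ => Sum.inl ()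
  | loop _ _ => Sum.inl ()

/-- Statements of stack machines with labels in `Λ`. -/
abbrev Code (Λ : Type) := TM2.Stmt (fun _ : Fin 4 => Γ') Λ (Option Γ')

/-- The machine code of a program, whose labels are embedded into `Λ` by `e`, and which goes to the
label `x` in the end. -/
def code {Λ : Type} : ∀ p : Prog, (p.Label → Λ) → Λ → p.Label → Code Λ
  | push k c, _, x, _ => .push k (fun _ => c) (.goto fun _ => x)
  | pushVar k, _, x, _ => .push k (fun v => v.getD .blank) (.goto fun _ => x)
  | pop k, _, x, _ => .pop k (fun _ c => c) (.goto fun _ => x)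
  | seq p q, e, x, l =>
    match l with
    | Sum.inl l => p.code (fun l => e (Sum.inl l)) (e (Sum.inr q.entry)) l
    | Sum.inr l => q.code (fun l => e (Sum.inr l)) x l
  | ite b p q, e, x, l =>
    match l with
    | Sum.inl _ =>
      .branch b (.goto fun _ => e (Sum.inr (Sum.inl p.entry)))
        (.goto fun _ => e (Sum.inr (Sum.inr q.entry)))
    | Sum.inr (Sum.inl l) => p.code (fun l => e (Sum.inr (Sum.inl l))) x l
    | Sum.inr (Sum.inr l) => q.code (fun l => e (Sum.inr (Sum.inr l))) x l
  | loop b p, e, x, l =>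
    match l with
    | Sum.inl _ => .branch b (.goto fun _ => e (Sum.inr p.entry)) (.goto fun _ => x)
    | Sum.inr l => p.code (fun l => e (Sum.inr l)) (e (Sum.inl ())) l

end Prog

/-- A machine that contains the code of a program simulates it step by step. -/
theorem Exec.simulate {Λ : Type} (M : Λ → Prog.Code Λ) {p v S n v' S'} (h : Exec p v S n v' S') :
    ∀ (e : p.Label → Λ) (x : Λ), (∀ l, M (e l) = p.code e x l) →
      (flip bind (TM2.step M))^[n] (some ⟨some (e p.entry), v, S⟩) =
        some ⟨some x, v', S'⟩ := by
  induction h with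
  | push k c v S =>
    intro e x hM
    change some (TM2.stepAux (M (e (Prog.push k c).entry)) v S) = _
    rw [hM]
    rfl
  | pushVar k v S =>
    intro e x hM
    change some (TM2.stepAux (M (e (Prog.pushVar k).entry)) v S) = _
    rw [hM]
    rfl
  | pop k v S =>
    intro e x hM
    change some (TM2.stepAux (M (e (Prog.pop k).entry)) v S) = _
    rw [hM]
    rfl
  | @seq p q v S n v' S' m v'' S'' hp hq ih1 ih2 =>
    intro e x hM
    -- The innermost iterate acts first, so the steps of `p` must be the right summand.
    rw [add_comm, Function.iterate_add_apply]
    erw [ih1 (fun l => e (Sum.inl l)) (e (Sum.inr q.entry)) (fun l => hM (Sum.inl l))]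
    exact ih2 (fun l => e (Sum.inr l)) x (fun l => hM (Sum.inr l))
  | @iteTrue b p q v S n v' S' hb hp ih =>
    intro e x hM
    rw [Function.iterate_add_apply]
    have h1 : (flip bind (TM2.step M))^[1] (some ⟨some (e (Prog.ite b p q).entry), v, S⟩) =
        some ⟨some (e (Sum.inr (Sum.inl p.entry))), v, S⟩ := by
      change some (TM2.stepAux (M (e (Prog.ite b p q).entry)) v S) = _
      rw [hM]
      change some (cond (b v) _ _) = _
      rw [hb]
      rfl
    rw [h1]
    exact ih _ x (fun l => hM (Sum.inr (Sum.inl l)))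
  | @iteFalse b p q v S n v' S' hb hp ih =>
    intro e x hM
    rw [Function.iterate_add_apply]
    have h1 : (flip bind (TM2.step M))^[1] (some ⟨some (e (Prog.ite b p q).entry), v, S⟩) =
        some ⟨some (e (Sum.inr (Sum.inr q.entry))), v, S⟩ := by
      change some (TM2.stepAux (M (e (Prog.ite b p q).entry)) v S) = _
      rw [hM]
      change some (cond (b v) _ _) = _
      rw [hb]
      rfl
    rw [h1]
    exact ih _ x (fun l => hM (Sum.inr (Sum.inr l)))
  | @loopDone b p v S hb =>
    intro e x hM
    change some (TM2.stepAux (M (e (Prog.loop b p).entry)) v S) = _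
    rw [hM]
    change some (cond (b v) _ _) = _
    rw [hb]
    rfl
  | @loopStep b p v S n v' S' m v'' S'' hb hp hq ih1 ih2 =>
    intro e x hM
    have h1 : (flip bind (TM2.step M))^[1] (some ⟨some (e (Prog.loop b p).entry), v, S⟩) =
        some ⟨some (e (Sum.inr p.entry)), v, S⟩ := by
      change some (TM2.stepAux (M (e (Prog.loop b p).entry)) v S) = _
      rw [hM]
      change some (cond (b v) _ _) = _
      rw [hb]
      rfl
    rw [Function.iterate_add_apply, h1, add_comm, Function.iterate_add_apply]
    erw [ih1 (fun l => e (Sum.inr l)) (e (Sum.inl ())) (fun l => hM (Sum.inr l))]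
    exact ih2 e x hM

/-- The machine that runs a program, with input on stack `1` and output on stack `2`. -/
def Prog.machine (p : Prog) : FinTM2 where
  K := Fin 4
  k₀ := 1
  k₁ := 2
  Γ _ := Γ'
  Λ := p.Label ⊕ Unit
  main := Sum.inl p.entry
  ΛFin := @instFintypeSum _ _ p.labelFintype _
  σ := Option Γ'
  initialState := none
  Γk₀Fin := inferInstanceAs (Fintype Γ')
  m
    | Sum.inl l => p.code Sum.inl (Sum.inr ()) l
    -- A halting configuration must have the initial value in its variable. The reset costs the
    -- extra step in the time bound `P + 1`.
    | Sum.inr _ => .load (fun _ => none) .halt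

/-- A function on words is computable in polynomial time if there is a program that computes it in
polynomially many steps. -/
theorem Prog.computableInPolyTime {α : Type} (p : Prog) (P : Polynomial ℕ) (f g : α → List Γ')
    (h : ∀ a, ∃ n ≤ P.eval (f a).length, ∃ v,
      Exec p none ![[], f a, [], []] n v ![[], [], g a, []]) :
    Nonempty (TM2ComputableInPolyTime f (fun y : List Γ' => y) g) := by
  refine ⟨{ tm := p.machine, inputAlphabet := Equiv.refl _, outputAlphabet := Equiv.refl _,
            time := P + 1, outputsFun := fun a => ?_ }⟩
  choose n hn v hv using h a
  refine ⟨⟨n + 1, ?_⟩, by simpa using hn⟩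
  have h0 : initList p.machine (List.map (Equiv.refl Γ').invFun (f a)) =
      ⟨some (Sum.inl p.entry), none, ![[], f a, [], []]⟩ := by
    unfold initList
    congr 1
    funext k
    change Fin 4 at k
    fin_cases k
    · rfl
    · exact (List.map_id _)
    · rfl
    · rfl
  have h1 : haltList p.machine (List.map (Equiv.refl Γ').invFun (g a)) =
      ⟨none, none, ![[], [], g a, []]⟩ := by
    unfold haltList
    congr 1
    funext k
    change Fin 4 at k
    fin_cases k
    · rfl
    · rfl
    · exact (List.map_id _)
    · rfl
  change (flip bind (TM2.step p.machine.m))^[n + 1] (some (initList p.machine _)) =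
    some (haltList p.machine _)
  erw [h0, h1]
  rw [add_comm, Function.iterate_add_apply]
  erw [hv.simulate p.machine.m Sum.inl (Sum.inr ()) (fun l => rfl)]
  rfl

/-! ### Trees as data -/

/-- Binary trees, the data of all computations. -/
inductive DataTree
  | leaf
  | node (a b : DataTree)

namespace DataTree

/-- A tree as a word, in prefix order. -/
def word : DataTree → List Γ'
  | leaf => [.ket]
  | node a b => .bra :: (word a ++ word b)

/-- The number of nodes and leaves. -/
def size (t : DataTree) : ℕ := t.word.length

@[simp] theorem size_leaf : size leaf = 1 := rfl

@[simp] theorem size_node (a b : DataTree) : size (node a b) = size a + size b + 1 := by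
  simp [size, word]

theorem size_pos (t : DataTree) : 0 < t.size := by
  cases t <;> simp

end DataTree

/-! ### Specifications -/

/-- Whatever its variable holds, the program `p` transforms `S` to `S'` in at most `N` steps. -/
def Spec (p : Prog) (S S' : Stacks) (N : ℕ) : Prop :=
  ∀ v, ∃ n ≤ N, ∃ v', Exec p v S n v' S'

theorem Spec.seq {p q S S' S'' N M} (hp : Spec p S S' N) (hq : Spec q S' S'' M) :
    Spec (.seq p q) S S'' (N + M) := by
  intro v
  obtain ⟨n, hn, v', h⟩ := hp v
  obtain ⟨m, hm, v'', h'⟩ := hq v'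
  exact ⟨n + m, by omega, v'', h.seq h'⟩

theorem Spec.mono {p S S' N M} (hp : Spec p S S' N) (h : N ≤ M) : Spec p S S' M := by
  intro v
  obtain ⟨n, hn, h'⟩ := hp v
  exact ⟨n, hn.trans h, h'⟩

section Update

variable (a b c d x : List Γ')

theorem update_stack_zero : Function.update ![a, b, c, d] 0 x = ![x, b, c, d] := by
  funext i; fin_cases i <;> rfl

theorem update_stack_one : Function.update ![a, b, c, d] 1 x = ![a, x, c, d] := by
  funext i; fin_cases i <;> rfl

theorem update_stack_two : Function.update ![a, b, c, d] 2 x = ![a, b, x, d] := by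
  funext i; fin_cases i <;> rfl

theorem update_stack_three : Function.update ![a, b, c, d] 3 x = ![a, b, c, x] := by
  funext i; fin_cases i <;> rfl

theorem Exec.push_zero (s : Γ') (v) : Exec (.push 0 s) v ![a, b, c, d] 1 v ![s :: a, b, c, d] := by
  simpa [update_stack_zero] using Exec.push 0 s v ![a, b, c, d]

theorem Exec.push_two (s : Γ') (v) : Exec (.push 2 s) v ![a, b, c, d] 1 v ![a, b, s :: c, d] := by
  simpa [update_stack_two] using Exec.push 2 s v ![a, b, c, d]

theorem Exec.push_three (s : Γ') (v) :
    Exec (.push 3 s) v ![a, b, c, d] 1 v ![a, b, c, s :: d] := by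
  simpa [update_stack_three] using Exec.push 3 s v ![a, b, c, d]

theorem Exec.pushVar_zero (s : Γ') :
    Exec (.pushVar 0) (some s) ![a, b, c, d] 1 (some s) ![s :: a, b, c, d] := by
  simpa [update_stack_zero] using Exec.pushVar 0 (some s) ![a, b, c, d]

theorem Exec.pushVar_one (s : Γ') :
    Exec (.pushVar 1) (some s) ![a, b, c, d] 1 (some s) ![a, s :: b, c, d] := by
  simpa [update_stack_one] using Exec.pushVar 1 (some s) ![a, b, c, d]

theorem Exec.pushVar_two (s : Γ') :
    Exec (.pushVar 2) (some s) ![a, b, c, d] 1 (some s) ![a, b, s :: c, d] := by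
  simpa [update_stack_two] using Exec.pushVar 2 (some s) ![a, b, c, d]

theorem Exec.pop_zero (v) : Exec (.pop 0) v ![a, b, c, d] 1 a.head? ![a.tail, b, c, d] := by
  simpa [update_stack_zero] using Exec.pop 0 v ![a, b, c, d]

theorem Exec.pop_zero_cons (s : Γ') (v) :
    Exec (.pop 0) v ![s :: a, b, c, d] 1 (some s) ![a, b, c, d] :=
  Exec.pop_zero (s :: a) b c d v

theorem Exec.pop_one (v) : Exec (.pop 1) v ![a, b, c, d] 1 b.head? ![a, b.tail, c, d] := by
  simpa [update_stack_one] using Exec.pop 1 v ![a, b, c, d]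

theorem Exec.pop_two (v) : Exec (.pop 2) v ![a, b, c, d] 1 c.head? ![a, b, c.tail, d] := by
  simpa [update_stack_two] using Exec.pop 2 v ![a, b, c, d]

theorem Exec.pop_three (v) : Exec (.pop 3) v ![a, b, c, d] 1 d.head? ![a, b, c, d.tail] := by
  simpa [update_stack_three] using Exec.pop 3 v ![a, b, c, d]

end Update

/-! ### Moving trees between stacks -/

namespace Prog

/-- One step of `moveTree`. The stack `3` counts the trees that are still to be read. -/
def moveBody (k : Fin 4) : Prog :=
  .seq (.pop 0) (.seq (.pushVar k)
    (.ite (fun v => v == some .bra) (.seq (.push 3 .blank) (.seq (.push 3 .blank) (.pop 3)))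
      (.pop 3)))

/-- Move the tree on top of stack `0` to stack `k`, in reverse order. -/
def moveTree (k : Fin 4) : Prog :=
  .seq (.push 3 .blank) (.seq (.pop 3) (.loop (fun v => v.isSome) (moveBody k)))

/-- Empty stack `1`. -/
def clear : Prog := .seq (.pop 1) (.loop (fun v => v.isSome) (.pop 1))

/-- Move stack `1` to stack `0`, in reverse order. -/
def pourOneZero : Prog :=
  .seq (.pop 1) (.loop (fun v => v.isSome) (.seq (.pushVar 0) (.pop 1)))

/-- Move stack `2` to stack `0`, in reverse order. -/
def pourTwoZero : Prog :=
  .seq (.pop 2) (.loop (fun v => v.isSome) (.seq (.pushVar 0) (.pop 2)))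

/-- Move stack `2` to stack `1`, in reverse order. -/
def pourTwoOne : Prog :=
  .seq (.pop 2) (.loop (fun v => v.isSome) (.seq (.pushVar 1) (.pop 2)))

/-- Move stack `1` to stack `0` and to stack `2`, in reverse order. -/
def pourBoth : Prog :=
  .seq (.pop 1) (.loop (fun v => v.isSome) (.seq (.pushVar 0) (.seq (.pushVar 2) (.pop 1))))

/-- Remove the tree on top of stack `0`. -/
def drop : Prog := .seq (moveTree 1) clear

/-- Duplicate the tree on top of stack `0`. -/
def dup : Prog := .seq (moveTree 1) (.seq pourBoth (.seq pourTwoOne pourOneZero))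

/-- Exchange the two trees on top of stack `0`. -/
def swap : Prog := .seq (moveTree 1) (.seq (moveTree 2) (.seq pourOneZero pourTwoZero))

end Prog

/-- A single loop runs through both subtrees of a node, so the claim has continuation form: a run
that starts after `t` extends to a run that starts before `t`. In this form the induction hypotheses
for the two subtrees can be chained. The variable holds the mark just taken from the counter on
stack `3`. -/
theorem moveLoop_one (t : DataTree) : ∀ x rest a b c, ∃ n ≤ 7 * t.size, ∀ m v' S',
    Exec (.loop (fun v => v.isSome) (.moveBody 1)) c.head?
      ![rest, t.word.reverse ++ a, b, c.tail] m v' S' →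
    Exec (.loop (fun v => v.isSome) (.moveBody 1)) (some x)
      ![t.word ++ rest, a, b, c] (n + m) v' S' := by
  induction t with
  | leaf =>
    intro x rest a b c
    refine ⟨5, by simp, fun m v' S' h => ?_⟩
    rw [add_right_comm 4 1 m]
    refine Exec.loopStep rfl ?_ h
    exact (Exec.pop_zero_cons _ _ _ _ .ket _).seq ((Exec.pushVar_one _ _ _ _ _).seq
      (Exec.iteFalse rfl (Exec.pop_three _ _ _ _ _)))
  | node s t ihs iht =>
    intro x rest a b c
    obtain ⟨n, hn, h1⟩ := ihs .blank (t.word ++ rest) (.bra :: a) b (.blank :: c)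
    obtain ⟨n', hn', h2⟩ := iht .blank rest (s.word.reverse ++ .bra :: a) b c
    -- Reading `bra` takes six steps and one loop test. It pushes two marks, one per subtree, and
    -- takes one back at once.
    refine ⟨7 + (n + n'), by simp; omega, fun m v' S' h => ?_⟩
    rw [show 7 + (n + n') + m = 6 + (n + (n' + m)) + 1 by omega]
    have h3 : Exec (.moveBody 1) (some x) ![(DataTree.node s t).word ++ rest, a, b, c] 6
        (some .blank) ![s.word ++ (t.word ++ rest), .bra :: a, b, .blank :: c] := by
      rw [DataTree.word, List.cons_append, List.append_assoc]
      refine (Exec.pop_zero_cons _ _ _ _ .bra _).seq ((Exec.pushVar_one _ _ _ _ .bra).seq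
        (Exec.iteTrue (n := 3) rfl ?_))
      exact (Exec.push_three _ _ _ _ _ _).seq ((Exec.push_three _ _ _ _ _ _).seq
        (Exec.pop_three _ _ _ _ _))
    refine Exec.loopStep rfl h3 (h1 _ _ _ (h2 _ _ _ ?_))
    simpa [DataTree.word] using h

theorem moveLoop_two (t : DataTree) : ∀ x rest a b c, ∃ n ≤ 7 * t.size, ∀ m v' S',
    Exec (.loop (fun v => v.isSome) (.moveBody 2)) c.head?
      ![rest, a, t.word.reverse ++ b, c.tail] m v' S' →
    Exec (.loop (fun v => v.isSome) (.moveBody 2)) (some x)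
      ![t.word ++ rest, a, b, c] (n + m) v' S' := by
  induction t with
  | leaf =>
    intro x rest a b c
    refine ⟨5, by simp, fun m v' S' h => ?_⟩
    rw [add_right_comm 4 1 m]
    refine Exec.loopStep rfl ?_ h
    exact (Exec.pop_zero_cons _ _ _ _ .ket _).seq ((Exec.pushVar_two _ _ _ _ _).seq
      (Exec.iteFalse rfl (Exec.pop_three _ _ _ _ _)))
  | node s t ihs iht =>
    intro x rest a b c
    obtain ⟨n, hn, h1⟩ := ihs .blank (t.word ++ rest) a (.bra :: b) (.blank :: c)
    obtain ⟨n', hn', h2⟩ := iht .blank rest a (s.word.reverse ++ .bra :: b) c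
    refine ⟨7 + (n + n'), by simp; omega, fun m v' S' h => ?_⟩
    rw [show 7 + (n + n') + m = 6 + (n + (n' + m)) + 1 by omega]
    have h3 : Exec (.moveBody 2) (some x) ![(DataTree.node s t).word ++ rest, a, b, c] 6
        (some .blank) ![s.word ++ (t.word ++ rest), a, .bra :: b, .blank :: c] := by
      rw [DataTree.word, List.cons_append, List.append_assoc]
      refine (Exec.pop_zero_cons _ _ _ _ .bra _).seq ((Exec.pushVar_two _ _ _ _ .bra).seq
        (Exec.iteTrue (n := 3) rfl ?_))
      exact (Exec.push_three _ _ _ _ _ _).seq ((Exec.push_three _ _ _ _ _ _).seq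
        (Exec.pop_three _ _ _ _ _))
    refine Exec.loopStep rfl h3 (h1 _ _ _ (h2 _ _ _ ?_))
    simpa [DataTree.word] using h

theorem spec_moveTree_one (t : DataTree) (rest a b) :
    Spec (.moveTree 1) ![t.word ++ rest, a, b, []] ![rest, t.word.reverse ++ a, b, []]
      (7 * t.size + 3) := by
  intro v
  obtain ⟨n, hn, h⟩ := moveLoop_one t .blank rest a b []
  exact ⟨1 + (1 + (n + 1)), by omega, _, (Exec.push_three _ _ _ _ _ _).seq
    ((Exec.pop_three _ _ _ _ _).seq (h _ _ _ (Exec.loopDone rfl)))⟩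

theorem spec_moveTree_two (t : DataTree) (rest a b) :
    Spec (.moveTree 2) ![t.word ++ rest, a, b, []] ![rest, a, t.word.reverse ++ b, []]
      (7 * t.size + 3) := by
  intro v
  obtain ⟨n, hn, h⟩ := moveLoop_two t .blank rest a b []
  exact ⟨1 + (1 + (n + 1)), by omega, _, (Exec.push_three _ _ _ _ _ _).seq
    ((Exec.pop_three _ _ _ _ _).seq (h _ _ _ (Exec.loopDone rfl)))⟩

theorem spec_clear (d a b c) :
    Spec .clear ![d, a, b, c] ![d, [], b, c] (4 * a.length + 2) := by
  have key : ∀ a : List Γ', ∃ n ≤ 4 * a.length + 1,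
      ∃ v', Exec (.loop (fun v => v.isSome) (.pop 1)) a.head? ![d, a.tail, b, c] n v'
        ![d, [], b, c] := by
    intro a
    induction a with
    | nil => exact ⟨1, le_rfl, _, Exec.loopDone rfl⟩
    | cons x a ih =>
      obtain ⟨n, hn, v', h⟩ := ih
      exact ⟨1 + n + 1, by simp; omega, v', Exec.loopStep rfl (Exec.pop_one _ _ _ _ _) h⟩
  intro v
  obtain ⟨n, hn, v', h⟩ := key a
  exact ⟨1 + n, by omega, v', (Exec.pop_one _ _ _ _ _).seq h⟩

theorem spec_pourOneZero (a : List Γ') (d b c) :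
    Spec .pourOneZero ![d, a, b, c] ![a.reverse ++ d, [], b, c] (4 * a.length + 2) := by
  have key : ∀ (a : List Γ') d, ∃ n ≤ 4 * a.length + 1, ∃ v',
      Exec (.loop (fun v => v.isSome) (.seq (.pushVar 0) (.pop 1))) a.head? ![d, a.tail, b, c] n v'
        ![a.reverse ++ d, [], b, c] := by
    intro a
    induction a with
    | nil => exact fun d => ⟨1, le_rfl, _, Exec.loopDone rfl⟩
    | cons x a ih =>
      intro d
      obtain ⟨n, hn, v', h⟩ := ih (x :: d)
      refine ⟨(1 + 1) + n + 1, by simp; omega, v', Exec.loopStep rfl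
        ((Exec.pushVar_zero _ _ _ _ _).seq (Exec.pop_one _ _ _ _ _)) ?_⟩
      simpa using h
  intro v
  obtain ⟨n, hn, v', h⟩ := key a d
  exact ⟨1 + n, by omega, v', (Exec.pop_one _ _ _ _ _).seq h⟩

theorem spec_pourTwoZero (b : List Γ') (d a c) :
    Spec .pourTwoZero ![d, a, b, c] ![b.reverse ++ d, a, [], c] (4 * b.length + 2) := by
  have key : ∀ (b : List Γ') d, ∃ n ≤ 4 * b.length + 1, ∃ v',
      Exec (.loop (fun v => v.isSome) (.seq (.pushVar 0) (.pop 2))) b.head? ![d, a, b.tail, c] n v'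
        ![b.reverse ++ d, a, [], c] := by
    intro b
    induction b with
    | nil => exact fun d => ⟨1, le_rfl, _, Exec.loopDone rfl⟩
    | cons x b ih =>
      intro d
      obtain ⟨n, hn, v', h⟩ := ih (x :: d)
      refine ⟨(1 + 1) + n + 1, by simp; omega, v', Exec.loopStep rfl
        ((Exec.pushVar_zero _ _ _ _ _).seq (Exec.pop_two _ _ _ _ _)) ?_⟩
      simpa using h
  intro v
  obtain ⟨n, hn, v', h⟩ := key b d
  exact ⟨1 + n, by omega, v', (Exec.pop_two _ _ _ _ _).seq h⟩

theorem spec_pourTwoOne (b : List Γ') (d a c) :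
    Spec .pourTwoOne ![d, a, b, c] ![d, b.reverse ++ a, [], c] (4 * b.length + 2) := by
  have key : ∀ (b : List Γ') a, ∃ n ≤ 4 * b.length + 1, ∃ v',
      Exec (.loop (fun v => v.isSome) (.seq (.pushVar 1) (.pop 2))) b.head? ![d, a, b.tail, c] n v'
        ![d, b.reverse ++ a, [], c] := by
    intro b
    induction b with
    | nil => exact fun a => ⟨1, le_rfl, _, Exec.loopDone rfl⟩
    | cons x b ih =>
      intro a
      obtain ⟨n, hn, v', h⟩ := ih (x :: a)
      refine ⟨(1 + 1) + n + 1, by simp; omega, v', Exec.loopStep rfl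
        ((Exec.pushVar_one _ _ _ _ _).seq (Exec.pop_two _ _ _ _ _)) ?_⟩
      simpa using h
  intro v
  obtain ⟨n, hn, v', h⟩ := key b a
  exact ⟨1 + n, by omega, v', (Exec.pop_two _ _ _ _ _).seq h⟩

theorem spec_pourBoth (a : List Γ') (d b c) :
    Spec .pourBoth ![d, a, b, c] ![a.reverse ++ d, [], a.reverse ++ b, c] (4 * a.length + 2) := by
  have key : ∀ (a : List Γ') d b, ∃ n ≤ 4 * a.length + 1, ∃ v',
      Exec (.loop (fun v => v.isSome) (.seq (.pushVar 0) (.seq (.pushVar 2) (.pop 1)))) a.head?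
        ![d, a.tail, b, c] n v' ![a.reverse ++ d, [], a.reverse ++ b, c] := by
    intro a
    induction a with
    | nil => exact fun d b => ⟨1, le_rfl, _, Exec.loopDone rfl⟩
    | cons x a ih =>
      intro d b
      obtain ⟨n, hn, v', h⟩ := ih (x :: d) (x :: b)
      refine ⟨(1 + (1 + 1)) + n + 1, by simp; omega, v', Exec.loopStep rfl
        ((Exec.pushVar_zero _ _ _ _ _).seq ((Exec.pushVar_two _ _ _ _ _).seq
          (Exec.pop_one _ _ _ _ _))) ?_⟩
      simpa using h
  intro v
  obtain ⟨n, hn, v', h⟩ := key a d b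
  exact ⟨1 + n, by omega, v', (Exec.pop_one _ _ _ _ _).seq h⟩

/-- The stacks between two steps of a computation on trees. -/
abbrev working (d : List Γ') : Stacks := ![d, [], [], []]

theorem spec_drop (t : DataTree) (rest) :
    Spec .drop (working (t.word ++ rest)) (working rest) (11 * t.size + 5) := by
  have h := (spec_moveTree_one t rest [] []).seq (spec_clear rest (t.word.reverse ++ []) [] [])
  exact h.mono (by simp [DataTree.size]; omega)

/-- Every move reverses a word. The copy on stack `2` is already in the right order and would arrive
reversed on stack `0`, hence the detour through stack `1`. -/
theorem spec_dup (t : DataTree) (rest) :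
    Spec .dup (working (t.word ++ rest)) (working (t.word ++ (t.word ++ rest)))
      (19 * t.size + 9) := by
  have h1 := spec_moveTree_one t rest [] []
  have h2 := spec_pourBoth (t.word.reverse ++ []) rest [] []
  have h3 := spec_pourTwoOne (t.word ++ []) (t.word ++ rest) [] []
  have h4 := spec_pourOneZero (t.word.reverse ++ []) (t.word ++ rest) [] []
  simp only [List.append_nil, List.reverse_reverse] at h1 h2 h3 h4
  exact (h1.seq (h2.seq (h3.seq h4))).mono (by simp [DataTree.size]; omega)

theorem spec_swap (s t : DataTree) (rest) :
    Spec .swap (working (s.word ++ (t.word ++ rest))) (working (t.word ++ (s.word ++ rest)))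
      (11 * (s.size + t.size) + 10) := by
  have h1 := spec_moveTree_one s (t.word ++ rest) [] []
  have h2 := spec_moveTree_two t rest (s.word.reverse ++ []) []
  have h3 := spec_pourOneZero (s.word.reverse ++ []) rest (t.word.reverse ++ []) []
  have h4 := spec_pourTwoZero (t.word.reverse ++ []) (s.word ++ rest) [] []
  simp only [List.append_nil, List.reverse_reverse] at h1 h2 h3 h4
  exact (h1.seq (h2.seq (h3.seq h4))).mono (by simp [DataTree.size]; omega)

/-! ### Polynomial bounds -/

/-- The coefficients are natural numbers. Monotonicity is what allows time and size bounds to be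
composed. -/
theorem polynomial_eval_mono (P : Polynomial ℕ) {a b : ℕ} (h : a ≤ b) : P.eval a ≤ P.eval b := by
  simp only [Polynomial.eval_eq_sum, Polynomial.sum]
  gcongr

/-- Types whose elements are encoded as trees. -/
class TreeEnc (α : Type) where
  /-- the encoding -/
  enc : α → DataTree

/-- The size of the encoding. -/
def sz {α : Type} [TreeEnc α] (x : α) : ℕ := (TreeEnc.enc x).size

/-- The encoding as a word. -/
def wd {α : Type} [TreeEnc α] (x : α) : List Γ' := (TreeEnc.enc x).word

instance : TreeEnc Unit := ⟨fun _ => .leaf⟩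

instance : TreeEnc Bool := ⟨fun b => if b then .node .leaf .leaf else .leaf⟩

instance {α β : Type} [TreeEnc α] [TreeEnc β] : TreeEnc (α × β) :=
  ⟨fun x => .node (TreeEnc.enc x.1) (TreeEnc.enc x.2)⟩

/-- The encoding of lists. -/
def encList {α : Type} [TreeEnc α] : List α → DataTree
  | [] => .leaf
  | a :: l => .node (TreeEnc.enc a) (encList l)

instance {α : Type} [TreeEnc α] : TreeEnc (List α) := ⟨encList⟩

/-- Unary numbers suffice for indices and counters, and arithmetic on them becomes list processing.
Weights, which may be exponentially large, are kept as lists of bits. -/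
instance : TreeEnc ℕ := ⟨fun n => encList (List.replicate n ())⟩

section Sizes

variable {α β : Type} [TreeEnc α] [TreeEnc β]

theorem sz_pos (a : α) : 0 < sz a := DataTree.size_pos _

theorem length_wd (a : α) : (wd a).length = sz a := rfl

@[simp] theorem sz_pair (a : α) (b : β) : sz (a, b) = sz a + sz b + 1 := DataTree.size_node _ _

@[simp] theorem sz_nil : sz ([] : List α) = 1 := rfl

@[simp] theorem sz_cons (a : α) (l : List α) : sz (a :: l) = sz a + sz l + 1 :=
  DataTree.size_node _ _

theorem sz_unit (a : Unit) : sz a = 1 := rfl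

theorem sz_bool_le (b : Bool) : sz b ≤ 3 := by cases b <;> decide

theorem length_le_sz (l : List α) : l.length ≤ sz l := by
  induction l with
  | nil => simp
  | cons a l ih => simp; omega

theorem sz_le_of_mem {a : α} {l : List α} (h : a ∈ l) : sz a ≤ sz l := by
  induction l with
  | nil => simp at h
  | cons b l ih =>
    rcases List.mem_cons.1 h with rfl | h
    · simp; omega
    · have := ih h; simp; omega

theorem sz_list_le {l : List α} {B : ℕ} (h : ∀ a ∈ l, sz a ≤ B) :
    sz l ≤ l.length * (B + 1) + 1 := by
  induction l with
  | nil => simp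
  | cons a l ih =>
    have h1 := ih fun b hb => h b (List.mem_cons_of_mem _ hb)
    have h2 := h a List.mem_cons_self
    rw [sz_cons, List.length_cons, Nat.succ_mul]
    omega

theorem sz_append (l l' : List α) : sz (l ++ l') + 1 = sz l + sz l' := by
  induction l with
  | nil => simp; omega
  | cons a l ih => simp; omega

theorem sz_nat (n : ℕ) : sz n = 2 * n + 1 := by
  change sz (List.replicate n ()) = _
  induction n with
  | zero => rfl
  | succ n ih => rw [List.replicate_succ, sz_cons, ih, sz_unit]; omega

theorem sz_bits_le (l : List Bool) : sz l ≤ 4 * l.length + 1 := by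
  have := sz_list_le (l := l) (B := 3) fun b _ => sz_bool_le b
  omega

@[simp] theorem wd_pair (a : α) (b : β) : wd (a, b) = .bra :: (wd a ++ wd b) := rfl

@[simp] theorem wd_nil : wd ([] : List α) = [.ket] := rfl

@[simp] theorem wd_cons (a : α) (l : List α) : wd (a :: l) = .bra :: (wd a ++ wd l) := rfl

end Sizes

/-- Functions on encoded data that are computed by a program in polynomial time. -/
def PolyTime {α β : Type} [TreeEnc α] [TreeEnc β] (f : α → β) : Prop :=
  ∃ (p : Prog) (P : Polynomial ℕ), ∀ x rest,
    Spec p (working (wd x ++ rest)) (working (wd (f x) ++ rest)) (P.eval (sz x))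

/-- Quantities that are bounded by a polynomial in the size of the argument. -/
def PolyBound {α : Type} [TreeEnc α] (g : α → ℕ) : Prop :=
  ∃ P : Polynomial ℕ, ∀ x, g x ≤ P.eval (sz x)

/-! ### Closure properties of polynomial bounds and of polynomial time. -/

section Basic

variable {α β γ δ : Type} [TreeEnc α] [TreeEnc β] [TreeEnc γ] [TreeEnc δ]

namespace PolyBound

theorem const (n : ℕ) : PolyBound (fun _ : α => n) := ⟨Polynomial.C n, fun x => by simp⟩

theorem size : PolyBound (fun x : α => sz x) := ⟨Polynomial.X, fun x => by simp⟩

theorem add {f g : α → ℕ} (hf : PolyBound f) (hg : PolyBound g) :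
    PolyBound (fun x => f x + g x) := by
  obtain ⟨P, hP⟩ := hf
  obtain ⟨Q, hQ⟩ := hg
  exact ⟨P + Q, fun x => by simpa using add_le_add (hP x) (hQ x)⟩

theorem mul {f g : α → ℕ} (hf : PolyBound f) (hg : PolyBound g) :
    PolyBound (fun x => f x * g x) := by
  obtain ⟨P, hP⟩ := hf
  obtain ⟨Q, hQ⟩ := hg
  exact ⟨P * Q, fun x => by simpa using Nat.mul_le_mul (hP x) (hQ x)⟩

theorem of_le {f g : α → ℕ} (hf : PolyBound f) (h : ∀ x, g x ≤ f x) : PolyBound g := by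
  obtain ⟨P, hP⟩ := hf
  exact ⟨P, fun x => (h x).trans (hP x)⟩

theorem comp_le {f : β → ℕ} (hf : PolyBound f) {g : α → β} (hg : PolyBound fun x => sz (g x)) :
    PolyBound fun x => f (g x) := by
  obtain ⟨P, hP⟩ := hf
  obtain ⟨Q, hQ⟩ := hg
  exact ⟨P.comp Q, fun x => by
    rw [Polynomial.eval_comp]; exact (hP _).trans (polynomial_eval_mono _ (hQ x))⟩

end PolyBound

theorem Spec.height_le {p d d' N} (h : Spec p (working d) (working d') N) :
    d'.length ≤ d.length + N := by
  obtain ⟨n, hn, v, h⟩ := h none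
  have := h.height_le
  simp [Fin.sum_univ_succ] at this
  omega

namespace PolyTime

/-- A step adds at most one symbol, so the output is no longer than the input plus the running time.
Hence compositions need no separate size estimates. -/
theorem size_bound {f : α → β} (hf : PolyTime f) : PolyBound fun x => sz (f x) := by
  obtain ⟨p, P, h⟩ := hf
  refine ⟨Polynomial.X + P, fun x => ?_⟩
  simpa [length_wd] using (h x []).height_le

theorem id : PolyTime (fun x : α => x) := by
  -- There is no empty program; a push undone by a pop takes its place.
  refine ⟨.seq (.push 0 .blank) (.pop 0), 2, fun x rest v => ⟨2, by simp, _,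
    (Exec.push_zero _ _ _ _ _ _).seq (Exec.pop_zero _ _ _ _ _)⟩⟩

theorem comp {g : β → γ} {f : α → β} (hg : PolyTime g) (hf : PolyTime f) :
    PolyTime fun x => g (f x) := by
  obtain ⟨R, hR⟩ := hf.size_bound
  obtain ⟨p, P, hp⟩ := hf
  obtain ⟨q, Q, hq⟩ := hg
  refine ⟨.seq p q, P + Q.comp R, fun x rest => ((hp x rest).seq (hq (f x) rest)).mono ?_⟩
  rw [Polynomial.eval_add, Polynomial.eval_comp]
  exact add_le_add le_rfl (polynomial_eval_mono _ (hR x))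

theorem of_eq {f g : α → β} (hf : PolyTime f) (h : ∀ x, g x = f x) : PolyTime g := by
  rwa [show g = f from funext h]

/-- A function whose values have the same encoding as the arguments. -/
theorem of_wd_eq {f : α → β} (h : ∀ x, wd (f x) = wd x) : PolyTime f := by
  obtain ⟨p, P, hp⟩ := PolyTime.id (α := α)
  exact ⟨p, P, fun x rest => by rw [h]; exact hp x rest⟩

theorem fst : PolyTime (Prod.fst : α × β → α) := by
  refine ⟨.seq (.pop 0) (.seq .swap .drop), 30 * Polynomial.X + 30, fun x rest v => ?_⟩
  obtain ⟨n, hn, v', h⟩ := ((spec_swap (TreeEnc.enc x.1) (TreeEnc.enc x.2) rest).seq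
    (spec_drop (TreeEnc.enc x.2) (wd x.1 ++ rest))) (some .bra)
  refine ⟨1 + n, ?_, v', ?_⟩
  · have : sz x = (TreeEnc.enc x.1).size + (TreeEnc.enc x.2).size + 1 := DataTree.size_node _ _
    simp
    omega
  · refine Exec.seq ?_ h
    rw [show wd x = .bra :: (wd x.1 ++ wd x.2) from rfl, List.cons_append, List.append_assoc]
    exact Exec.pop_zero_cons _ _ _ _ _ _

theorem snd : PolyTime (Prod.snd : α × β → β) := by
  refine ⟨.seq (.pop 0) .drop, 30 * Polynomial.X + 30, fun x rest v => ?_⟩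
  obtain ⟨n, hn, v', h⟩ := (spec_drop (TreeEnc.enc x.1) (wd x.2 ++ rest)) (some .bra)
  refine ⟨1 + n, ?_, v', ?_⟩
  · have : sz x = (TreeEnc.enc x.1).size + (TreeEnc.enc x.2).size + 1 := DataTree.size_node _ _
    simp
    omega
  · refine Exec.seq ?_ h
    rw [show wd x = .bra :: (wd x.1 ++ wd x.2) from rfl, List.cons_append, List.append_assoc]
    exact Exec.pop_zero_cons _ _ _ _ _ _

/-- Programs leave the part of the stack below their argument untouched, so `g` can run above a
saved copy of the argument and `f` above the value of `g`. A final `bra` joins the two trees. -/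
theorem pair {f : α → β} {g : α → γ} (hf : PolyTime f) (hg : PolyTime g) :
    PolyTime fun x => (f x, g x) := by
  obtain ⟨R, hR⟩ := hg.size_bound
  obtain ⟨p, P, hp⟩ := hf
  obtain ⟨q, Q, hq⟩ := hg
  refine ⟨.seq .dup (.seq q (.seq .swap (.seq p (.push 0 .bra)))),
    (19 * Polynomial.X + 9) + (Q + (11 * (R + Polynomial.X) + 10 + (P + 1))), fun x rest => ?_⟩
  have h1 := spec_dup (TreeEnc.enc x) rest
  have h2 := hq x (wd x ++ rest)
  have h3 := spec_swap (TreeEnc.enc (g x)) (TreeEnc.enc x) rest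
  have h4 := hp x (wd (g x) ++ rest)
  have h5 : Spec (.push 0 .bra) (working (wd (f x) ++ (wd (g x) ++ rest)))
      (working (wd (f x, g x) ++ rest)) 1 := by
    intro v
    refine ⟨1, le_rfl, v, ?_⟩
    rw [wd_pair, List.cons_append, List.append_assoc]
    exact Exec.push_zero _ _ _ _ _ _
  refine (h1.seq (h2.seq (h3.seq (h4.seq h5)))).mono ?_
  have := hR x
  simp only [Polynomial.eval_add, Polynomial.eval_mul, Polynomial.eval_X, Polynomial.eval_ofNat,
    Polynomial.eval_one]
  change 19 * sz x + 9 + (_ + (11 * (sz (g x) + sz x) + 10 + _)) ≤ _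
  gcongr

theorem const (b : β) : PolyTime (fun _ : α => b) := by
  have key : ∀ (l : List Γ') , ∃ p N, ∀ rest, Spec p (working rest) (working (l ++ rest)) N := by
    intro l
    induction l with
    | nil => exact ⟨.seq (.push 0 .blank) (.pop 0), 2, fun rest v => ⟨2, by simp, _,
        (Exec.push_zero _ _ _ _ _ _).seq (Exec.pop_zero _ _ _ _ _)⟩⟩
    | cons c l ih =>
      obtain ⟨p, N, h⟩ := ih
      exact ⟨.seq p (.push 0 c), N + 1, fun rest => (h rest).seq fun v =>
        ⟨1, le_rfl, v, Exec.push_zero _ _ _ _ _ _⟩⟩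
  obtain ⟨p, N, h⟩ := key (wd b)
  refine ⟨.seq .drop p, 11 * Polynomial.X + 5 + Polynomial.C N, fun x rest =>
    ((spec_drop (TreeEnc.enc x) rest).seq (h rest)).mono ?_⟩
  simp only [Polynomial.eval_add, Polynomial.eval_mul, Polynomial.eval_X, Polynomial.eval_ofNat,
    Polynomial.eval_C]
  exact le_rfl

/-- A nonempty list has the same encoding as the pair of its head and tail, so nothing is left to
compute after pairing. -/
theorem cons {f : α → β} {g : α → List β} (hf : PolyTime f) (hg : PolyTime g) :
    PolyTime fun x => f x :: g x :=
  comp (g := fun y : β × List β => y.1 :: y.2) (of_wd_eq fun _ => rfl) (hf.pair hg)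

theorem succ {f : α → ℕ} (hf : PolyTime f) : PolyTime fun x => f x + 1 :=
  comp (g := fun y : Unit × ℕ => y.2 + 1) (of_wd_eq fun _ => rfl) ((const ()).pair hf)

/-- Case distinction for Booleans. -/
theorem cond {c : α → Bool} {f g h : α → β} (hc : PolyTime c) (hf : PolyTime f) (hg : PolyTime g)
    (h1 : ∀ x, c x = true → h x = f x) (h0 : ∀ x, c x = false → h x = g x) : PolyTime h := by
  obtain ⟨r, R, hr⟩ := hc
  obtain ⟨p, P, hp⟩ := hf
  obtain ⟨q, Q, hq⟩ := hg
  -- The first symbol of the Boolean decides: `ket` is all of `false`, while after the `bra` of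
  -- `true` two leaves remain to be removed.
  refine ⟨.seq .dup (.seq r (.seq (.pop 0)
    (.ite (fun v => v == some .bra) (.seq (.pop 0) (.seq (.pop 0) p)) q))),
    (19 * Polynomial.X + 9) + (R + (P + Q + 10)), fun x rest => ?_⟩
  intro v
  obtain ⟨n, hn, v', h3⟩ := spec_dup (TreeEnc.enc x) rest v
  obtain ⟨m, hm, v'', h4⟩ := hr x (wd x ++ rest) v'
  have e : (19 * Polynomial.X + 9 + (R + (P + Q + 10))).eval (sz x) =
      (19 * sz x + 9) + (R.eval (sz x) + (P.eval (sz x) + Q.eval (sz x) + 10)) := by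
    simp only [Polynomial.eval_add, Polynomial.eval_mul, Polynomial.eval_X, Polynomial.eval_ofNat]
  change n ≤ 19 * sz x + 9 at hn
  rw [e]
  rcases hb : c x with _ | _
  · rw [hb] at h4
    rw [h0 x hb]
    obtain ⟨k, hk, v₃, h5⟩ := hq x rest (some .ket)
    exact ⟨n + (m + (1 + (k + 1))), by omega, v₃, h3.seq (h4.seq
      ((Exec.pop_zero_cons _ _ _ _ .ket _).seq (Exec.iteFalse rfl h5)))⟩
  · rw [hb] at h4
    rw [h1 x hb]
    obtain ⟨k, hk, v₃, h5⟩ := hp x rest (some .ket)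
    exact ⟨n + (m + (1 + ((1 + (1 + k)) + 1))), by omega, v₃, h3.seq (h4.seq
      ((Exec.pop_zero_cons _ _ _ _ .bra _).seq (Exec.iteTrue rfl
        ((Exec.pop_zero_cons _ _ _ _ .ket _).seq ((Exec.pop_zero_cons _ _ _ _ .ket _).seq h5)))))⟩

/-- Case distinction for lists. -/
theorem listCases {l : α → List β} {f h : α → γ} {g : α × β × List β → γ} (hl : PolyTime l)
    (hf : PolyTime f) (hg : PolyTime g) (h0 : ∀ x, l x = [] → h x = f x)
    (h1 : ∀ x b t, l x = b :: t → h x = g (x, b, t)) : PolyTime h := by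
  obtain ⟨L, hL⟩ := hl.size_bound
  obtain ⟨r, R, hr⟩ := hl
  obtain ⟨p, P, hp⟩ := hf
  obtain ⟨q, Q, hq⟩ := hg
  -- A leading `bra` means that the list is nonempty. Pushing it back makes the pair of head and
  -- tail, which goes below the saved argument; another `bra` completes the triple.
  refine ⟨.seq .dup (.seq r (.seq (.pop 0)
    (.ite (fun v => v == some .bra) (.seq (.push 0 .bra) (.seq .swap (.seq (.push 0 .bra) q))) p))),
    (19 * Polynomial.X + 9) + (R + (P + Q.comp (Polynomial.X + L + 1) +
      (11 * (Polynomial.X + L) + 10) + 10)), fun x rest => ?_⟩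
  intro v
  obtain ⟨n, hn, v', h3⟩ := spec_dup (TreeEnc.enc x) rest v
  obtain ⟨m, hm, v'', h4⟩ := hr x (wd x ++ rest) v'
  simp only [Polynomial.eval_add, Polynomial.eval_mul, Polynomial.eval_X, Polynomial.eval_ofNat,
    Polynomial.eval_comp, Polynomial.eval_one]
  change n ≤ 19 * sz x + 9 at hn
  have hLx : sz (l x) ≤ L.eval (sz x) := hL x
  rcases hb : l x with _ | ⟨b, t⟩
  · rw [hb] at h4
    rw [h0 x hb]
    obtain ⟨k, hk, v₃, h5⟩ := hp x rest (some .ket)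
    exact ⟨n + (m + (1 + (k + 1))), by omega, v₃, h3.seq (h4.seq
      ((Exec.pop_zero_cons _ _ _ _ .ket _).seq (Exec.iteFalse rfl h5)))⟩
  · rw [hb] at h4 hLx
    rw [h1 x b t hb]
    obtain ⟨j, hj, v₃, h5⟩ := spec_swap (TreeEnc.enc (b, t)) (TreeEnc.enc x) rest (some .bra)
    obtain ⟨k, hk, v₄, h6⟩ := hq (x, b, t) rest v₃
    have hk' : k ≤ Q.eval (sz x + L.eval (sz x) + 1) := by
      refine hk.trans (polynomial_eval_mono _ ?_)
      simp at hLx ⊢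
      omega
    have hj' : j ≤ 11 * (sz x + L.eval (sz x)) + 10 := by
      change j ≤ 11 * (sz (b, t) + sz x) + 10 at hj
      simp at hLx hj
      omega
    have h7 : Exec (.push 0 .bra) (some .bra) (working (wd b ++ (wd t ++ (wd x ++ rest)))) 1
        (some .bra) (working (wd (b, t) ++ (wd x ++ rest))) := by
      rw [wd_pair, List.cons_append, List.append_assoc]
      exact Exec.push_zero _ _ _ _ _ _
    have h8 : Exec (.push 0 .bra) v₃ (working (wd x ++ (wd (b, t) ++ rest))) 1
        v₃ (working (wd (x, b, t) ++ rest)) := by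
      rw [wd_pair x, List.cons_append, List.append_assoc]
      exact Exec.push_zero _ _ _ _ _ _
    have h9 : Exec (.pop 0) v'' (working (wd (b :: t) ++ (wd x ++ rest))) 1 (some .bra)
        (working (wd b ++ (wd t ++ (wd x ++ rest)))) := by
      rw [wd_cons, List.cons_append, List.append_assoc]
      exact Exec.pop_zero_cons _ _ _ _ _ _
    exact ⟨n + (m + (1 + ((1 + (j + (1 + k))) + 1))), by omega, v₄, h3.seq (h4.seq
      (h9.seq (Exec.iteTrue rfl (h7.seq (h5.seq (h8.seq h6))))))⟩

/-- The body of the loop that iterates a program. -/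
def _root_.FairDivision.Prog.iterateBody (p : Prog) : Prog :=
  .seq .drop (.seq .swap (.seq p (.seq .swap (.pop 0))))

/-- The list is the counter of the loop. It lies above the current value, with its first symbol
already in the variable. A round drops the head, brings the value to the top, applies `p`, and
restores the order. -/
theorem iterate_loop {f : α → α} {p : Prog} {P : Polynomial ℕ}
    (hp : ∀ x rest, Spec p (working (wd x ++ rest)) (working (wd (f x) ++ rest)) (P.eval (sz x)))
    (B L : ℕ) (rest : List Γ') (l : List δ) : ∀ x : α, sz l ≤ L →
      (∀ j ≤ l.length, sz (f^[j] x) ≤ B) →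
      ∃ n ≤ l.length * (33 * L + 22 * B + P.eval B + 27) + 1, ∃ v',
        Exec (.loop (fun v => v == some .bra) (.iterateBody p)) (wd l).head?
          (working ((wd l).tail ++ (wd x ++ rest))) n v'
          (working (wd (f^[l.length] x) ++ rest)) := by
  induction l with
  | nil => exact fun x _ _ => ⟨1, by simp, _, Exec.loopDone rfl⟩
  | cons a l ih =>
    intro x hL hB
    obtain ⟨n, hn, v', h⟩ := ih (f x) (by simp at hL; omega) fun j hj => by
      simpa using hB (j + 1) (by simpa using hj)
    obtain ⟨n₁, hn₁, v₁, h₁⟩ := spec_drop (TreeEnc.enc a) (wd l ++ (wd x ++ rest)) (some .bra)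
    obtain ⟨n₂, hn₂, v₂, h₂⟩ := spec_swap (TreeEnc.enc l) (TreeEnc.enc x) rest v₁
    obtain ⟨n₃, hn₃, v₃, h₃⟩ := hp x (wd l ++ rest) v₂
    obtain ⟨n₄, hn₄, v₄, h₄⟩ := spec_swap (TreeEnc.enc (f x)) (TreeEnc.enc l) rest v₃
    have h₅ := Exec.pop_zero (wd l ++ (wd (f x) ++ rest)) [] [] [] v₄
    have e1 : (wd l ++ (wd (f x) ++ rest)).head? = (wd l).head? := by
      cases l <;> rfl
    have e2 : (wd l ++ (wd (f x) ++ rest)).tail = (wd l).tail ++ (wd (f x) ++ rest) := by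
      cases l <;> rfl
    rw [e1, e2] at h₅
    have hx := hB 0 (Nat.zero_le _)
    have hfx := hB 1 (by simp)
    simp only [Function.iterate_zero_apply, Function.iterate_one] at hx hfx
    refine ⟨(n₁ + (n₂ + (n₃ + (n₄ + 1)))) + n + 1, ?_, v', ?_⟩
    · change n₁ ≤ 11 * sz a + 5 at hn₁
      change n₂ ≤ 11 * (sz l + sz x) + 10 at hn₂
      change n₄ ≤ 11 * (sz (f x) + sz l) + 10 at hn₄
      have := polynomial_eval_mono P hx
      simp only [sz_cons] at hL
      rw [List.length_cons, Nat.succ_mul]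
      omega
    · refine Exec.loopStep rfl ?_ h
      have : (wd (a :: l)).tail ++ (wd x ++ rest) = wd a ++ (wd l ++ (wd x ++ rest)) := by simp
      rw [this]
      exact h₁.seq (h₂.seq (h₃.seq (h₄.seq h₅)))

/-- Iteration, as often as a list has elements, when the sizes of all intermediate results are
bounded. -/
theorem iterate {f : α → α} {l : γ → List δ} {x : γ → α} (hf : PolyTime f) (hl : PolyTime l)
    (hx : PolyTime x)
    (hB : ∃ Q : Polynomial ℕ, ∀ c, ∀ j ≤ (l c).length, sz (f^[j] (x c)) ≤ Q.eval (sz c)) :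
    PolyTime fun c => f^[(l c).length] (x c) := by
  obtain ⟨B, hB⟩ := hB
  obtain ⟨L, hL⟩ := hl.size_bound
  obtain ⟨p, P, hp⟩ := hf
  obtain ⟨q, Q, hq⟩ := hl
  obtain ⟨r, R, hr⟩ := hx
  refine ⟨.seq .dup (.seq r (.seq .swap (.seq q (.seq (.pop 0)
    (.loop (fun v => v == some .bra) (.iterateBody p)))))),
    (19 * Polynomial.X + 9) + (R + ((11 * (B + Polynomial.X) + 10) + (Q + (1 +
      (L * (33 * L + 22 * B + P.comp B + 27) + 1))))), fun c rest v => ?_⟩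
  obtain ⟨n₁, hn₁, v₁, h₁⟩ := spec_dup (TreeEnc.enc c) rest v
  obtain ⟨n₂, hn₂, v₂, h₂⟩ := hr c (wd c ++ rest) v₁
  obtain ⟨n₃, hn₃, v₃, h₃⟩ := spec_swap (TreeEnc.enc (x c)) (TreeEnc.enc c) rest v₂
  obtain ⟨n₄, hn₄, v₄, h₄⟩ := hq c (wd (x c) ++ rest) v₃
  have h₅ := Exec.pop_zero (wd (l c) ++ (wd (x c) ++ rest)) [] [] [] v₄
  have e1 : (wd (l c) ++ (wd (x c) ++ rest)).head? = (wd (l c)).head? := by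
    cases l c <;> rfl
  have e2 : (wd (l c) ++ (wd (x c) ++ rest)).tail = (wd (l c)).tail ++ (wd (x c) ++ rest) := by
    cases l c <;> rfl
  rw [e1, e2] at h₅
  obtain ⟨n₆, hn₆, v₆, h₆⟩ := iterate_loop hp (B.eval (sz c)) (L.eval (sz c)) rest (l c) (x c)
    (hL c) (hB c)
  refine ⟨n₁ + (n₂ + (n₃ + (n₄ + (1 + n₆)))), ?_, v₆,
    h₁.seq (h₂.seq (h₃.seq (h₄.seq (h₅.seq h₆))))⟩
  simp only [Polynomial.eval_add, Polynomial.eval_mul, Polynomial.eval_X, Polynomial.eval_ofNat,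
    Polynomial.eval_comp, Polynomial.eval_one]
  have hx := hB c 0 (Nat.zero_le _)
  rw [Function.iterate_zero_apply] at hx
  change n₁ ≤ 19 * sz c + 9 at hn₁
  change n₃ ≤ 11 * (sz (x c) + sz c) + 10 at hn₃
  have h7 := Nat.mul_le_mul_right (33 * L.eval (sz c) + 22 * B.eval (sz c) +
    P.eval (B.eval (sz c)) + 27) ((length_le_sz (l c)).trans (hL c))
  omega

/-- Folds whose intermediate results have bounded size. -/
theorem foldl {s : γ × β × α → β} {l : γ → List α} {i : γ → β} (hs : PolyTime s) (hl : PolyTime l)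
    (hi : PolyTime i) (hB : ∃ Q : Polynomial ℕ, ∀ c l', l' <+: l c →
      sz (l'.foldl (fun b a => s (c, b, a)) (i c)) ≤ Q.eval (sz c)) :
    PolyTime fun c => (l c).foldl (fun b a => s (c, b, a)) (i c) := by
  -- The state of the iteration consists of the parameter, the accumulator and the unread part of
  -- the list. The list itself also counts the rounds.
  let step : γ × β × List α → γ × β × List α := fun y =>
    match y.2.2 with
    | [] => y
    | a :: t => (y.1, s (y.1, y.2.1, a), t)
  have hstep : PolyTime step := by
    refine listCases (l := fun y : γ × β × List α => y.2.2) (f := fun y => y)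
      (g := fun z => (z.1.1, s (z.1.1, z.1.2.1, z.2.1), z.2.2)) (snd.comp snd) PolyTime.id ?_
      ?_ ?_
    · have h1 : PolyTime (fun z : (γ × β × List α) × α × List α => z.1.1) := fst.comp fst
      have h2 : PolyTime (fun z : (γ × β × List α) × α × List α => z.1.2.1) :=
        fst.comp (snd.comp fst)
      have h3 : PolyTime (fun z : (γ × β × List α) × α × List α => z.2.1) := fst.comp snd
      exact h1.pair ((hs.comp (h1.pair (h2.pair h3))).pair (snd.comp snd))
    · rintro ⟨c, b, l⟩ h
      simp only at h
      subst h
      rfl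
    · rintro ⟨c, b, l⟩ a t h
      simp only at h
      subst h
      rfl
  have key : ∀ c (l : List α) b j, step^[j] (c, b, l) =
      (c, (l.take j).foldl (fun b a => s (c, b, a)) b, l.drop j) := by
    intro c l b j
    induction j generalizing l b with
    | zero => simp
    | succ j ih =>
      rw [Function.iterate_succ_apply]
      cases l with
      | nil => simpa [step] using ih [] b
      | cons a t => simpa [step] using ih t (s (c, b, a))
  have h := iterate (l := l) (x := fun c => (c, i c, l c)) hstep hl (PolyTime.id.pair (hi.pair hl))
    (by
      obtain ⟨Q, hQ⟩ := hB
      obtain ⟨L, hL⟩ := hl.size_bound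
      refine ⟨Polynomial.X + (Q + L + 1) + 1, fun c j _ => ?_⟩
      rw [key]
      have h1 := hQ c _ (List.take_prefix j (l c))
      have h2 : sz ((l c).drop j) ≤ L.eval (sz c) := by
        have h3 := sz_append ((l c).take j) ((l c).drop j)
        rw [List.take_append_drop] at h3
        have : sz (l c) ≤ L.eval (sz c) := hL c
        have := sz_pos ((l c).take j)
        omega
      simp only [sz_pair, Polynomial.eval_add, Polynomial.eval_X, Polynomial.eval_one]
      omega)
  exact (fst.comp (snd.comp h)).of_eq fun c => by
    simp only [key, List.take_length]

end PolyTime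

end Basic

/-! ### A library of polynomial time functions -/

namespace PolyTime

variable {α β γ δ : Type} [TreeEnc α] [TreeEnc β] [TreeEnc γ] [TreeEnc δ]

/-- An invariant preserved by the elements of the list holds for the result on every prefix, and
these are the only values whose size matters. -/
theorem foldl_of_invariant {s : γ × β × α → β} {l : γ → List α} {i : γ → β} (hs : PolyTime s)
    (hl : PolyTime l) (hi : PolyTime i) (Inv : γ → β → Prop) (h0 : ∀ c, Inv c (i c))
    (h1 : ∀ c b a, a ∈ l c → Inv c b → Inv c (s (c, b, a)))
    {K : γ → ℕ} (hK : PolyBound K) (h2 : ∀ c b, Inv c b → sz b ≤ K c) :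
    PolyTime fun c => (l c).foldl (fun b a => s (c, b, a)) (i c) := by
  obtain ⟨Q, hQ⟩ := hK
  refine foldl hs hl hi ⟨Q, fun c l' hl' => (h2 c _ ?_).trans (hQ c)⟩
  have key : ∀ (l' : List α) b, (∀ a ∈ l', a ∈ l c) → Inv c b →
      Inv c (l'.foldl (fun b a => s (c, b, a)) b) := by
    intro l'
    induction l' with
    | nil => exact fun b _ h => h
    | cons a t ih =>
      exact fun b h hb => ih _ (fun a' h' => h a' (List.mem_cons_of_mem _ h'))
        (h1 c b a (h a List.mem_cons_self) hb)
  exact key l' _ (fun a ha => hl'.subset ha) (h0 c)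

/-- Folds with a measure that bounds the size and grows by a bounded amount. -/
theorem foldl_of_measure {s : γ × β × α → β} {l : γ → List α} {i : γ → β} (hs : PolyTime s)
    (hl : PolyTime l) (hi : PolyTime i) (μ : β → ℕ) {K : γ → ℕ} (hK : PolyBound K)
    (h0 : ∀ c, μ (i c) ≤ K c) (h1 : ∀ c b a, a ∈ l c → μ (s (c, b, a)) ≤ μ b + K c)
    (h2 : ∀ b, sz b ≤ 4 * μ b + 1) :
    PolyTime fun c => (l c).foldl (fun b a => s (c, b, a)) (i c) := by
  obtain ⟨Q, hQ⟩ := hK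
  obtain ⟨L, hL⟩ := hl.size_bound
  refine foldl hs hl hi ⟨4 * ((L + 1) * Q) + 1, fun c l' hl' => ?_⟩
  have key : ∀ (l' : List α) b, (∀ a ∈ l', a ∈ l c) →
      μ (l'.foldl (fun b a => s (c, b, a)) b) ≤ μ b + l'.length * K c := by
    intro l'
    induction l' with
    | nil => exact fun b _ => by simp
    | cons a t ih =>
      intro b h
      have h3 := ih (s (c, b, a)) (fun a' h' => h a' (List.mem_cons_of_mem _ h'))
      have h4 := h1 c b a (h a List.mem_cons_self)
      rw [List.foldl_cons, List.length_cons, Nat.succ_mul]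
      omega
  have h3 := key l' (i c) (fun a ha => hl'.subset ha)
  have h4 := h0 c
  have h5 : (l'.length + 1) * K c ≤ (L.eval (sz c) + 1) * Q.eval (sz c) :=
    Nat.mul_le_mul (Nat.succ_le_succ (hl'.length_le.trans ((length_le_sz _).trans (hL c)))) (hQ c)
  have h6 := h2 (l'.foldl (fun b a => s (c, b, a)) (i c))
  rw [Nat.succ_mul] at h5
  simp only [Polynomial.eval_add, Polynomial.eval_mul, Polynomial.eval_ofNat, Polynomial.eval_one]
  omega

theorem foldl_of_size {s : γ × β × α → β} {l : γ → List α} {i : γ → β} (hs : PolyTime s)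
    (hl : PolyTime l) (hi : PolyTime i) {K : γ → ℕ} (hK : PolyBound K)
    (h1 : ∀ c b a, a ∈ l c → sz (s (c, b, a)) ≤ sz b + K c) :
    PolyTime fun c => (l c).foldl (fun b a => s (c, b, a)) (i c) :=
  foldl_of_measure hs hl hi (fun b => sz b) (hK.add hi.size_bound) (fun c => by omega)
    (fun c b a ha => by have := h1 c b a ha; omega) (fun b => by omega)

theorem replicate {n : γ → ℕ} (hn : PolyTime n) :
    PolyTime fun c => List.replicate (n c) () :=
  comp (g := fun n : ℕ => List.replicate n ()) (of_wd_eq fun _ => rfl) hn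

/-- Iteration of a function with a parameter. -/
theorem iterate_of_invariant {f : γ × β → β} {n : γ → ℕ} {i : γ → β} (hf : PolyTime f)
    (hn : PolyTime n) (hi : PolyTime i) (Inv : γ → β → Prop) (h0 : ∀ c, Inv c (i c))
    (h1 : ∀ c b, Inv c b → Inv c (f (c, b))) {K : γ → ℕ} (hK : PolyBound K)
    (h2 : ∀ c b, Inv c b → sz b ≤ K c) :
    PolyTime fun c => (fun b => f (c, b))^[n c] (i c) := by
  have h := foldl_of_invariant (s := fun y : γ × β × Unit => f (y.1, y.2.1))
    (hf.comp (fst.pair (fst.comp snd))) hn.replicate hi Inv h0 (fun c b a _ => h1 c b) hK h2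
  refine h.of_eq fun c => ?_
  generalize i c = b
  induction n c generalizing b with
  | zero => rfl
  | succ k ih => rw [Function.iterate_succ_apply, List.replicate_succ, List.foldl_cons, ih]

theorem reverse {l : γ → List α} (hl : PolyTime l) : PolyTime fun c => (l c).reverse := by
  have h := foldl_of_size (s := fun y : γ × List α × α => y.2.2 :: y.2.1) (i := fun _ => [])
    ((snd.comp snd).cons (fst.comp snd)) hl (const []) (hl.size_bound.add (.const 1))
    (fun c b a ha => by have := sz_le_of_mem ha; simp; omega)
  exact h.of_eq fun c => by simp [List.foldl_flip_cons_eq_append]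

theorem map {g : γ × α → β} {l : γ → List α} (hg : PolyTime g) (hl : PolyTime l) :
    PolyTime fun c => (l c).map fun a => g (c, a) := by
  obtain ⟨G, hG⟩ := hg.size_bound
  -- The bound `G` is treated as a function of a unary number, so that composition of polynomial
  -- bounds applies.
  have hK : PolyBound fun c => G.eval (sz c + sz (l c) + 1) + 1 :=
    (PolyBound.comp_le (f := fun n : ℕ => G.eval n) (g := fun c => sz c + sz (l c) + 1)
      ⟨G, fun n => polynomial_eval_mono _ (by rw [sz_nat]; omega)⟩ (by
        refine (((PolyBound.size.add hl.size_bound).mul (.const 2)).add (.const 3)).of_le ?_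
        intro c; rw [sz_nat]; omega)).add (.const 1)
  have h := foldl_of_size (s := fun y : γ × List β × α => g (y.1, y.2.2) :: y.2.1)
    (i := fun _ => []) ((hg.comp (fst.pair (snd.comp snd))).cons (fst.comp snd)) hl (const []) hK
    (fun c b a ha => by
      have h1 : sz (g (c, a)) ≤ G.eval (sz (c, a)) := hG (c, a)
      have h2 := polynomial_eval_mono G (show sz (c, a) ≤ sz c + sz (l c) + 1 by
        have := sz_le_of_mem ha; simp; omega)
      simp; omega)
  refine h.reverse.of_eq fun c => ?_
  have : ∀ (l : List α) (b : List β), l.foldl (fun b a => g (c, a) :: b) b =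
      (l.map fun a => g (c, a)).reverse ++ b := by
    intro l
    induction l with
    | nil => simp
    | cons a t ih => intro b; simp [ih]
  simp [this]

theorem append {f g : γ → List α} (hf : PolyTime f) (hg : PolyTime g) :
    PolyTime fun c => f c ++ g c := by
  have h := foldl_of_size (s := fun y : γ × List α × α => y.2.2 :: y.2.1)
    ((snd.comp snd).cons (fst.comp snd)) hf.reverse hg (hf.size_bound.add (.const 1))
    (fun c b a ha => by have := sz_le_of_mem (List.mem_reverse.1 ha); simp; omega)
  exact h.of_eq fun c => by simp

theorem flatten {f : γ → List (List α)} (hf : PolyTime f) : PolyTime fun c => (f c).flatten := by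
  have h := foldl_of_size (s := fun y : γ × List α × List α => y.2.1 ++ y.2.2)
    (i := fun _ => []) ((fst.comp snd).append (snd.comp snd)) hf (const []) hf.size_bound
    (fun c b a ha => by
      have := sz_le_of_mem ha
      have := sz_append b a
      simp; omega)
  refine h.of_eq fun c => ?_
  have : ∀ (l : List (List α)) (b : List α), l.foldl (fun b a => b ++ a) b = b ++ l.flatten := by
    intro l
    induction l with
    | nil => simp
    | cons a t ih => intro b; simp [ih]
  exact ((this _ _).trans (List.nil_append _)).symm

theorem flatMap {g : γ × α → List β} {l : γ → List α} (hg : PolyTime g) (hl : PolyTime l) :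
    PolyTime fun c => (l c).flatMap fun a => g (c, a) :=
  (hg.map hl).flatten.of_eq fun c => by rw [List.flatMap_def]

theorem length {l : γ → List α} (hl : PolyTime l) : PolyTime fun c => (l c).length := by
  have h := foldl_of_size (s := fun y : γ × ℕ × α => y.2.1 + 1) (i := fun _ => 0)
    (fst.comp snd).succ hl (const 0) (.const 2) (fun c b a ha => by simp [sz_nat]; omega)
  exact h.of_eq fun c => by simp

theorem tail {l : γ → List α} (hl : PolyTime l) : PolyTime fun c => (l c).tail :=
  listCases hl (const []) (g := fun y => y.2.2) (snd.comp snd) (fun _ h => by rw [h]; rfl)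
    (fun _ _ _ h => by rw [h]; rfl)

theorem headD {l : γ → List α} (hl : PolyTime l) (d : α) : PolyTime fun c => (l c).headD d :=
  listCases hl (const d) (g := fun y => y.2.1) (fst.comp snd) (fun _ h => by rw [h]; rfl)
    (fun _ _ _ h => by rw [h]; rfl)

theorem isEmpty {l : γ → List α} (hl : PolyTime l) : PolyTime fun c => (l c).isEmpty :=
  listCases hl (const true) (g := fun _ => false) (const false) (fun _ h => by rw [h]; rfl)
    (fun _ _ _ h => by rw [h]; rfl)

theorem drop {n : γ → ℕ} {l : γ → List α} (hn : PolyTime n) (hl : PolyTime l) :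
    PolyTime fun c => (l c).drop (n c) := by
  have h := iterate_of_invariant (f := fun y : γ × List α => y.2.tail) snd.tail hn hl
    (fun c b => sz b ≤ sz (l c)) (fun c => le_rfl)
    (fun c b hb => by cases b <;> simp at hb ⊢ <;> omega) hl.size_bound (fun c b hb => hb)
  refine h.of_eq fun c => ?_
  generalize l c = l
  simp only
  induction n c generalizing l with
  | zero => rfl
  | succ k ih => rw [Function.iterate_succ_apply, ← ih, List.drop_tail]

theorem getD {l : γ → List α} {n : γ → ℕ} (hl : PolyTime l) (hn : PolyTime n) (d : α) :
    PolyTime fun c => (l c).getD (n c) d :=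
  ((hn.drop hl).headD d).of_eq fun c => by
    simp [List.getD_eq_getElem?_getD, List.head?_drop, List.headD_eq_head?_getD]

theorem not {f : γ → Bool} (hf : PolyTime f) : PolyTime fun c => !f c :=
  cond hf (const false) (const true) (fun _ h => by rw [h]; rfl) (fun _ h => by rw [h]; rfl)

theorem and {f g : γ → Bool} (hf : PolyTime f) (hg : PolyTime g) : PolyTime fun c => f c && g c :=
  cond hf hg (const false) (fun _ h => by rw [h]; rfl) (fun _ h => by rw [h]; rfl)

theorem or {f g : γ → Bool} (hf : PolyTime f) (hg : PolyTime g) : PolyTime fun c => f c || g c :=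
  cond hf (const true) hg (fun _ h => by rw [h]; rfl) (fun _ h => by rw [h]; rfl)

theorem xor {f g : γ → Bool} (hf : PolyTime f) (hg : PolyTime g) :
    PolyTime fun c => Bool.xor (f c) (g c) :=
  cond hf hg.not hg (fun _ h => by rw [h]; simp) (fun _ h => by rw [h]; simp)

theorem ite {b : γ → Bool} {f g : γ → α} (hb : PolyTime b) (hf : PolyTime f) (hg : PolyTime g) :
    PolyTime fun c => if b c = true then f c else g c :=
  cond hb hf hg (fun _ h => by simp [h]) (fun _ h => by simp [h])

theorem nat_add {m n : γ → ℕ} (hm : PolyTime m) (hn : PolyTime n) :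
    PolyTime fun c => m c + n c :=
  (hm.replicate.append hn.replicate).length.of_eq fun c => by simp

theorem nat_sub {m n : γ → ℕ} (hm : PolyTime m) (hn : PolyTime n) :
    PolyTime fun c => m c - n c :=
  (hn.drop hm.replicate).length.of_eq fun c => by simp

/-- Two numbers are equal when both truncated differences vanish. -/
theorem nat_beq {m n : γ → ℕ} (hm : PolyTime m) (hn : PolyTime n) :
    PolyTime fun c => m c == n c :=
  ((hm.nat_sub hn).replicate.isEmpty.and (hn.nat_sub hm).replicate.isEmpty).of_eq fun c => by
    rw [Bool.eq_iff_iff]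
    simp
    omega

theorem range {n : γ → ℕ} (hn : PolyTime n) : PolyTime fun c => List.range (n c) := by
  -- The next entry of the range is the length of the part built so far, so no separate counter is
  -- needed.
  have key : ∀ k, (fun b : List ℕ => b ++ [b.length])^[k] [] = List.range k := by
    intro k
    induction k with
    | zero => rfl
    | succ k ih => rw [Function.iterate_succ_apply', ih, List.range_succ, List.length_range]
  have hs : PolyTime fun b : List ℕ => b ++ [b.length] :=
    PolyTime.id.append (PolyTime.id.length.cons (const []))
  have h := iterate (x := fun _ : γ => ([] : List ℕ)) hs hn.replicate (const []) (by
    have h1 : PolyBound fun c => sz (n c) * (2 * sz (n c) + 2) + 1 :=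
      (hn.size_bound.mul (((PolyBound.const 2).mul hn.size_bound).add (.const 2))).add (.const 1)
    obtain ⟨Q, hQ⟩ := h1
    refine ⟨Q, fun c j hj => le_trans ?_ (hQ c)⟩
    rw [List.length_replicate] at hj
    rw [key]
    have h2 := sz_list_le (l := List.range j) (B := 2 * sz (n c) + 1) fun a ha => by
      have := List.mem_range.1 ha
      rw [sz_nat, sz_nat]
      omega
    rw [List.length_range] at h2
    refine h2.trans (Nat.add_le_add_right (Nat.mul_le_mul_right _ ?_) 1)
    rw [sz_nat]
    omega)
  exact h.of_eq fun c => by rw [key, List.length_replicate]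

end PolyTime

/-! ### Binary arithmetic -/

/-- The value of a binary number, least significant bit first. -/
def bitsVal : List Bool → ℕ
  | [] => 0
  | b :: l => b.toNat + 2 * bitsVal l

/-- The pairs of corresponding bits of two binary numbers. -/
def zipBits (x y : List Bool) : List (Bool × Bool) :=
  -- Padding with zeros to a length that suffices for both avoids a case distinction on the lengths.
  (List.range (x.length + y.length)).map fun k => (x.getD k false, y.getD k false)

/-- A step of the addition of binary numbers. -/
def addStep (s : Bool × List Bool) (p : Bool × Bool) : Bool × List Bool :=
  -- The first component is the carry, the majority of three bits; the second collects the digits,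
  -- latest first.
  ((p.1 && p.2) || (s.1 && (p.1 || p.2)), Bool.xor s.1 (Bool.xor p.1 p.2) :: s.2)

/-- The sum of two binary numbers. -/
def addBits (x y : List Bool) : List Bool :=
  let s := (zipBits x y).foldl addStep (false, [])
  (s.1 :: s.2).reverse

/-- Comparison of two binary numbers. -/
def ltBits (x y : List Bool) : Bool :=
  -- The last difference met is the most significant one and overrides the earlier ones.
  (zipBits x y).foldl (fun b p => if Bool.xor p.1 p.2 = true then p.2 else b) false

/-- The product of two binary numbers. -/
def mulBits (x y : List Bool) : List Bool :=
  -- Horner's scheme from the most significant bit; prepending `false` doubles.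
  x.reverse.foldl (fun s b => if b = true then addBits (false :: s) y else false :: s) []

theorem bitsVal_map_range (x : List Bool) (n : ℕ) (h : x.length ≤ n) :
    bitsVal ((List.range n).map fun k => x.getD k false) = bitsVal x := by
  induction n generalizing x with
  | zero => simp_all [List.length_eq_zero_iff]
  | succ n ih =>
    rw [List.range_succ_eq_map, List.map_cons, List.map_map]
    cases x with
    | nil =>
      have := ih [] (Nat.zero_le _)
      simpa [bitsVal, Function.comp_def] using this
    | cons b x =>
      have := ih x (by simpa using h)
      simp only [bitsVal, Function.comp_def, List.getD_cons_succ, List.getD_cons_zero]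
      rw [this]

theorem bitsVal_zipBits_fst (x y : List Bool) :
    bitsVal ((zipBits x y).map Prod.fst) = bitsVal x := by
  rw [zipBits, List.map_map]
  exact bitsVal_map_range x _ (by omega)

theorem bitsVal_zipBits_snd (x y : List Bool) :
    bitsVal ((zipBits x y).map Prod.snd) = bitsVal y := by
  rw [zipBits, List.map_map]
  exact bitsVal_map_range y _ (by omega)

theorem bitsVal_append (x y : List Bool) :
    bitsVal (x ++ y) = bitsVal x + 2 ^ x.length * bitsVal y := by
  induction x with
  | nil => simp [bitsVal]
  | cons b x ih => simp only [List.cons_append, bitsVal, ih, List.length_cons]; ring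

theorem bitsVal_addBits (x y : List Bool) : bitsVal (addBits x y) = bitsVal x + bitsVal y := by
  -- Invariant: the digits written so far, plus the carry and the unread parts at their place value,
  -- have a constant sum.
  have key : ∀ (z : List (Bool × Bool)) (s : Bool × List Bool),
      bitsVal ((z.foldl addStep s).1 :: (z.foldl addStep s).2).reverse =
        bitsVal s.2.reverse + 2 ^ s.2.length *
          (s.1.toNat + bitsVal (z.map Prod.fst) + bitsVal (z.map Prod.snd)) := by
    intro z
    induction z with
    | nil => intro s; simp [bitsVal_append, bitsVal]
    | cons p z ih =>
      intro s
      rw [List.foldl_cons, ih]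
      obtain ⟨c, out⟩ := s
      obtain ⟨a, b⟩ := p
      simp only [addStep, List.reverse_cons, bitsVal_append, bitsVal, List.map_cons,
        List.length_cons, List.length_reverse]
      cases a <;> cases b <;> cases c <;> simp <;> ring
  rw [addBits, key, bitsVal_zipBits_fst, bitsVal_zipBits_snd]
  simp [bitsVal]

theorem ltBits_eq (x y : List Bool) : ltBits x y = decide (bitsVal x < bitsVal y) := by
  have key : ∀ (z : List (Bool × Bool)) (b : Bool),
      z.foldl (fun b p => if Bool.xor p.1 p.2 = true then p.2 else b) b =
        decide (bitsVal (z.map Prod.fst) < bitsVal (z.map Prod.snd) ∨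
          bitsVal (z.map Prod.fst) = bitsVal (z.map Prod.snd) ∧ b = true) := by
    intro z
    induction z with
    | nil => intro b; simp
    | cons p z ih =>
      intro b
      rw [List.foldl_cons, ih]
      obtain ⟨u, v⟩ := p
      rw [decide_eq_decide]
      cases u <;> cases v <;> cases b <;> simp [bitsVal] <;> omega
  rw [ltBits, key, bitsVal_zipBits_fst, bitsVal_zipBits_snd]
  simp

theorem bitsVal_mulBits (x y : List Bool) : bitsVal (mulBits x y) = bitsVal x * bitsVal y := by
  rw [mulBits, List.foldl_reverse]
  induction x with
  | nil => simp [bitsVal]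
  | cons b x ih =>
    rw [List.foldr_cons]
    cases b <;> simp [bitsVal, bitsVal_addBits, ih] <;> ring

/-- The padding makes sums longer than necessary, but repeated addition of a fixed number still
lengthens the accumulator only linearly. This keeps products and counts polynomial. -/
theorem length_addBits (x y : List Bool) : (addBits x y).length = x.length + y.length + 1 := by
  have key : ∀ (z : List (Bool × Bool)) (s : Bool × List Bool),
      (z.foldl addStep s).2.length = s.2.length + z.length := by
    intro z
    induction z with
    | nil => simp
    | cons p z ih => intro s; rw [List.foldl_cons, ih]; simp [addStep]; omega
  simp [addBits, key, zipBits]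

/-! ### Running time of the binary arithmetic. -/

namespace PolyTime

variable {γ : Type} [TreeEnc γ]

theorem zipBits {x y : γ → List Bool} (hx : PolyTime x) (hy : PolyTime y) :
    PolyTime fun c => zipBits (x c) (y c) :=
  map (g := fun p : γ × ℕ => ((x p.1).getD p.2 false, (y p.1).getD p.2 false))
    (((hx.comp fst).getD snd false).pair ((hy.comp fst).getD snd false))
    (hx.length.nat_add hy.length).range

theorem addBits {x y : γ → List Bool} (hx : PolyTime x) (hy : PolyTime y) :
    PolyTime fun c => addBits (x c) (y c) := by
  have a : PolyTime fun p : γ × (Bool × List Bool) × (Bool × Bool) => p.2.2.1 :=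
    fst.comp (snd.comp snd)
  have b : PolyTime fun p : γ × (Bool × List Bool) × (Bool × Bool) => p.2.2.2 :=
    snd.comp (snd.comp snd)
  have s : PolyTime fun p : γ × (Bool × List Bool) × (Bool × Bool) => p.2.1.1 :=
    fst.comp (fst.comp snd)
  have o : PolyTime fun p : γ × (Bool × List Bool) × (Bool × Bool) => p.2.1.2 :=
    snd.comp (fst.comp snd)
  have hs : PolyTime fun p : γ × (Bool × List Bool) × (Bool × Bool) => addStep p.2.1 p.2.2 :=
    ((a.and b).or (s.and (a.or b))).pair ((s.xor (a.xor b)).cons o)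
  have h := foldl_of_measure hs (hx.zipBits hy) (const (false, [])) (fun b => b.2.length + 1)
    (.const 1) (fun _ => by simp) (fun c b a _ => by simp [addStep])
    (fun b => by
      obtain ⟨b, l⟩ := b
      have := sz_bits_le l
      have := sz_bool_le b
      simp
      omega)
  exact ((fst.comp h).cons (snd.comp h)).reverse

theorem ltBits {x y : γ → List Bool} (hx : PolyTime x) (hy : PolyTime y) :
    PolyTime fun c => ltBits (x c) (y c) := by
  have a : PolyTime fun p : γ × Bool × (Bool × Bool) => p.2.2.1 := fst.comp (snd.comp snd)
  have b : PolyTime fun p : γ × Bool × (Bool × Bool) => p.2.2.2 := snd.comp (snd.comp snd)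
  exact foldl_of_invariant ((a.xor b).ite b (fst.comp snd)) (hx.zipBits hy) (const false)
    (fun _ _ => True) (fun _ => trivial) (fun _ _ _ _ _ => trivial) (.const 3)
    (fun _ b _ => sz_bool_le b)

theorem mulBits {x y : γ → List Bool} (hx : PolyTime x) (hy : PolyTime y) :
    PolyTime fun c => mulBits (x c) (y c) := by
  have s : PolyTime fun p : γ × List Bool × Bool => false :: p.2.1 :=
    (const false).cons (fst.comp snd)
  refine foldl_of_measure (s := fun p : γ × List Bool × Bool =>
    if p.2.2 = true then FairDivision.addBits (false :: p.2.1) (y p.1) else false :: p.2.1)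
    ((snd.comp snd).ite (s.addBits (hy.comp fst)) s)
    hx.reverse (const []) List.length (hy.size_bound.add (.const 2))
    (fun _ => by simp) (fun c b a _ => ?_) sz_bits_le
  have := length_le_sz (y c)
  cases a <;> simp [length_addBits]
  omega

end PolyTime

/-! ### Locally optimal assignments -/

section LocalSearch

variable {N M : Type*}

/-- Every item is assigned to an agent who likes it, if there is one. -/
def IsClean (L : M → N → Prop) (o : M → N) : Prop :=
  ∀ g i, L g i → L g (o g)

open scoped Classical in
theorem IsClean.update {L : M → N → Prop} {o : M → N} (h : IsClean L o) {g : M} {i : N}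
    (hi : L g i) : IsClean L (Function.update o g i) := by
  intro g' k hk
  by_cases e : g' = g
  · subst e; simpa using hi
  · simpa [e] using h g' k hk

variable [Fintype M]

open scoped Classical in
/-- The number of items that are assigned to agent `i` and liked by `i`. -/
noncomputable def valuedCount (L : M → N → Prop) (o : M → N) (i : N) : ℕ :=
  (Finset.univ.filter fun g => o g = i ∧ L g i).card

/-- Agent `i` should get item `g` from its owner. -/
def IsViolation (L : M → N → Prop) (w : N → ℝ) (o : M → N) (g : M) (i : N) : Prop :=
  -- Even without `g`, the weighted value of the owner would exceed the present one of `i`.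
  L g i ∧ L g (o g) ∧
    (valuedCount L o i : ℝ) / w i < ((valuedCount L o (o g) : ℝ) - 1) / w (o g)

open scoped Classical in
/-- The number of pairs `(i, k)` with `k < |M|` and `k / w i < r`. -/
noncomputable def slotRank (M : Type*) [Fintype N] [Fintype M] (w : N → ℝ) (r : ℝ) : ℕ :=
  -- Ranks are natural numbers bounded independently of the weights; this makes the number of
  -- transfers polynomial.
  (Finset.univ.filter fun x : N × Fin (Fintype.card M) => ((x.2 : ℕ) : ℝ) / w x.1 < r).card

/-- The potential of an assignment. -/
noncomputable def potential [Fintype N] (L : M → N → Prop) (w : N → ℝ) (o : M → N) : ℕ :=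
  ∑ i, ∑ k ∈ Finset.range (valuedCount L o i), slotRank M w (k / w i)

theorem slotRank_le [Fintype N] (w : N → ℝ) (r : ℝ) :
    slotRank M w r ≤ Fintype.card N * Fintype.card M := by
  classical
  refine (Finset.card_filter_le _ _).trans ?_
  simp

theorem sum_valuedCount_le [Fintype N] (L : M → N → Prop) (o : M → N) :
    ∑ i, valuedCount L o i ≤ Fintype.card M := by
  classical
  have h : ∑ i, (Finset.univ.filter fun g => o g = i).card = Fintype.card M := by
    rw [← Finset.card_univ]
    exact (Finset.card_eq_sum_card_fiberwise fun g _ => Finset.mem_univ (o g)).symm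
  rw [← h]
  refine Finset.sum_le_sum fun i _ => Finset.card_le_card fun g hg => ?_
  simp only [Finset.mem_filter, Finset.mem_univ, true_and] at hg ⊢
  exact hg.1

/-- At most one slot is occupied per item, and each rank is at most the number of possible slots. -/
theorem potential_le [Fintype N] (L : M → N → Prop) (w : N → ℝ) (o : M → N) :
    potential L w o ≤ Fintype.card M * (Fintype.card N * Fintype.card M) := by
  calc potential L w o
      ≤ ∑ i, valuedCount L o i * (Fintype.card N * Fintype.card M) := by
        refine Finset.sum_le_sum fun i _ => ?_
        refine (Finset.sum_le_card_nsmul _ _ _ fun k _ => slotRank_le w _).trans ?_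
        simp
    _ ≤ _ := by
        rw [← Finset.sum_mul]
        exact Nat.mul_le_mul_right _ (sum_valuedCount_le L o)

open scoped Classical in
theorem valuedCount_update_self (L : M → N → Prop) (o : M → N) (g : M) (i : N) (hi : L g i)
    (hne : o g ≠ i) : valuedCount L (Function.update o g i) i = valuedCount L o i + 1 := by
  have : (Finset.univ.filter fun h => Function.update o g i h = i ∧ L h i) =
      insert g (Finset.univ.filter fun h => o h = i ∧ L h i) := by
    ext h
    by_cases hh : h = g
    · subst hh; simp [hi]
    · simp [hh]
  rw [valuedCount, this, Finset.card_insert_of_notMem (by simp [hne])]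
  rfl

open scoped Classical in
theorem valuedCount_update_owner (L : M → N → Prop) (o : M → N) (g : M) (i : N)
    (hj : L g (o g)) (hne : o g ≠ i) :
    valuedCount L (Function.update o g i) (o g) + 1 = valuedCount L o (o g) := by
  have : (Finset.univ.filter fun h => o h = o g ∧ L h (o g)) =
      insert g (Finset.univ.filter fun h => Function.update o g i h = o g ∧ L h (o g)) := by
    ext h
    by_cases hh : h = g
    · subst hh; simp [hj]
    · simp [hh]
  rw [valuedCount, valuedCount, this, Finset.card_insert_of_notMem (by simp [hne.symm])]

open scoped Classical in
theorem valuedCount_update_of_ne (L : M → N → Prop) (o : M → N) (g : M) (i k : N)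
    (hki : k ≠ i) (hkj : k ≠ o g) :
    valuedCount L (Function.update o g i) k = valuedCount L o k := by
  rw [valuedCount, valuedCount]
  congr 1
  ext h
  by_cases hh : h = g
  · subst hh; simp [hki.symm, hkj.symm]
  · simp [hh]

open scoped Classical in
/-- The transfer of an item at a violation makes the potential smaller. -/
theorem potential_update_lt [Fintype N] {L : M → N → Prop} {w : N → ℝ} (hw : ∀ i, 0 < w i) {o : M → N} {g : M}
    {i : N} (h : IsViolation L w o g i) :
    potential L w (Function.update o g i) < potential L w o := by
  obtain ⟨hi, hj, hlt⟩ := h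
  have hne : o g ≠ i := by
    intro e
    rw [e] at hlt
    exact absurd hlt (not_lt.2 (div_le_div_of_nonneg_right (by linarith) (hw i).le))
  have h1 := valuedCount_update_self L o g i hi hne
  have h2 := valuedCount_update_owner L o g i hj hne
  -- The item leaves the last slot of its owner for the first free slot of `i`, whose value is
  -- smaller by the violation. The rank falls strictly since the new slot counts in the old rank but
  -- not in its own. Its index is admissible because `i` does not own `g`.
  have hrank : slotRank M w ((valuedCount L o i : ℝ) / w i) <
      slotRank M w (((valuedCount L (Function.update o g i) (o g) : ℕ) : ℝ) / w (o g)) := by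
    have h3 : ((valuedCount L (Function.update o g i) (o g) : ℕ) : ℝ) =
        (valuedCount L o (o g) : ℝ) - 1 := by
      rw [← h2]; push_cast; ring
    rw [h3]
    have hcard : valuedCount L o i < Fintype.card M := by
      rw [valuedCount, ← Finset.card_univ]
      refine Finset.card_lt_card (Finset.ssubset_univ_iff.2 fun e => ?_)
      have := e ▸ Finset.mem_univ g
      simp [hne] at this
    refine Finset.card_lt_card (Finset.ssubset_iff_of_subset ?_ |>.2 ?_)
    · intro x hx
      simp only [Finset.mem_filter, Finset.mem_univ, true_and] at hx ⊢
      exact hx.trans hlt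
    · exact ⟨(i, ⟨_, hcard⟩), by simpa using hlt, by simp⟩
  set o' := Function.update o g i with ho'
  have hs : ∀ f : N → ℕ, ∑ k, f k = f i + (f (o g) + ∑ k ∈ (Finset.univ.erase i).erase (o g), f k) :=
    fun f => by
      rw [Finset.add_sum_erase _ f (Finset.mem_erase.2 ⟨hne, Finset.mem_univ _⟩),
        Finset.add_sum_erase _ f (Finset.mem_univ _)]
  rw [potential, potential, hs, hs (fun k => ∑ x ∈ Finset.range (valuedCount L o k), _)]
  have h4 : ∑ k ∈ (Finset.univ.erase i).erase (o g),
        ∑ x ∈ Finset.range (valuedCount L o' k), slotRank M w (x / w k) =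
      ∑ k ∈ (Finset.univ.erase i).erase (o g),
        ∑ x ∈ Finset.range (valuedCount L o k), slotRank M w (x / w k) := by
    refine Finset.sum_congr rfl fun k hk => ?_
    simp only [Finset.mem_erase] at hk
    rw [ho', valuedCount_update_of_ne L o g i k hk.2.1 hk.1]
  rw [h4, h1, ← h2, Finset.sum_range_succ, Finset.sum_range_succ]
  omega

/-- There is a clean assignment without violations. -/
theorem exists_isClean_forall_not_isViolation [Fintype N] [Nonempty N] (L : M → N → Prop) {w : N → ℝ}
    (hw : ∀ i, 0 < w i) : ∃ o : M → N, IsClean L o ∧ ∀ g i, ¬ IsViolation L w o g i := by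
  classical
  have hne : ∃ o : M → N, IsClean L o := by
    refine ⟨fun g => if h : ∃ i, L g i then h.choose else Classical.arbitrary N, fun g i hi => ?_⟩
    have h : ∃ i, L g i := ⟨i, hi⟩
    simp only [h, dif_pos]
    exact h.choose_spec
  -- A clean assignment of least potential admits no violation, because the transfer would stay
  -- clean.
  let s : Set ℕ := {p | ∃ o, IsClean L o ∧ potential L w o = p}
  have hs : s.Nonempty := ⟨_, hne.choose, hne.choose_spec, rfl⟩
  obtain ⟨o, ho, hp⟩ := Nat.sInf_mem hs
  refine ⟨o, ho, fun g i hv => ?_⟩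
  have h1 := potential_update_lt hw hv
  have h2 : sInf s ≤ potential L w (Function.update o g i) :=
    Nat.sInf_le ⟨_, ho.update hv.1, rfl⟩
  omega

end LocalSearch

/-! ### Fairness of locally optimal assignments -/

section Fairness

variable {N M : Type*}

/-- Agent `i` has a positive value for item `g`. -/
def Likes (I : SocialImpactInstance N M) (g : M) (i : N) : Prop := 0 < I.val i g

open scoped Classical in
theorem bundleVal_eq_card {I : SocialImpactInstance N M} (hb : I.IsBinary) (i : N) (S : Finset M) :
    I.bundleVal i S = (S.filter fun g => Likes I g i).card := by
  rw [SocialImpactInstance.bundleVal, Finset.card_filter]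
  refine Finset.sum_congr rfl fun g _ => ?_
  rcases hb i g with h | h <;> simp [Likes, h]

variable [Fintype M]

open scoped Classical in
/-- The allocation in which every agent gets the items that are assigned to it. -/
noncomputable def allocationOf (o : M → N) : Allocation N M where
  bundle i := Finset.univ.filter fun g => o g = i
  disjoint i j hij := by
    rw [Finset.disjoint_left]
    intro g hi hj
    simp only [Finset.mem_filter, Finset.mem_univ, true_and] at hi hj
    exact hij (hi.symm.trans hj)
  cover g := ⟨o g, by simp⟩

@[simp] theorem mem_allocationOf {o : M → N} {g : M} {i : N} :
    g ∈ (allocationOf o).bundle i ↔ o g = i := by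
  simp [allocationOf]

/-- Covering gives each item an owner, and disjointness makes the owner unique. -/
theorem exists_eq_allocationOf (A : Allocation N M) : ∃ o, A = allocationOf o := by
  choose o ho using A.cover
  refine ⟨o, ?_⟩
  obtain ⟨b, hd, hc⟩ := A
  have : b = (allocationOf o).bundle := by
    funext i
    ext g
    rw [mem_allocationOf]
    refine ⟨fun h => ?_, fun h => h ▸ ho g⟩
    by_contra hne
    exact Finset.disjoint_left.1 (hd _ _ hne) (ho g) h
  subst this
  rfl

variable {I : SocialImpactInstance N M}

theorem socialImpact_allocationOf [Fintype N] (o : M → N) :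
    socialImpact I (allocationOf o) = ∑ g, I.impact (o g) g := by
  classical
  rw [← Finset.sum_fiberwise_of_maps_to (g := o) (t := Finset.univ) fun g _ => Finset.mem_univ _]
  refine Finset.sum_congr rfl fun i _ => ?_
  rw [SocialImpactInstance.bundleImpact]
  have : (allocationOf o).bundle i = Finset.univ.filter fun g => o g = i := by
    ext; simp
  rw [this]
  refine Finset.sum_congr rfl fun g hg => ?_
  simp only [Finset.mem_filter, Finset.mem_univ, true_and] at hg
  rw [hg]

/-- The social impact is a sum over items, and a clean owner attains the maximum for each item
separately. -/
theorem isSIM_allocationOf [Fintype N] (hb : I.IsBinary) (he : I.ValEqImpact) {o : M → N}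
    (ho : IsClean (Likes I) o) : IsSIM I (allocationOf o) := by
  intro A'
  obtain ⟨o', rfl⟩ := exists_eq_allocationOf A'
  rw [socialImpact_allocationOf, socialImpact_allocationOf]
  refine Finset.sum_le_sum fun g _ => ?_
  rw [← he, ← he]
  rcases hb (o' g) g with h | h
  · omega
  · have : 0 < I.val (o g) g := ho g (o' g) (by rw [Likes]; omega)
    omega

theorem bundleVal_allocationOf [Fintype N] (hb : I.IsBinary) (o : M → N) (i : N) :
    I.bundleVal i ((allocationOf o).bundle i) = valuedCount (Likes I) o i := by
  classical
  rw [bundleVal_eq_card hb, valuedCount]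
  congr 1
  ext g
  simp

variable [DecidableEq M]

/-- Without violations, removing any item that is liked by its owner from the bundle of the owner
eliminates the weighted envy of all agents. -/
theorem bundleVal_sdiff_le [Fintype N] (hb : I.IsBinary) {w : N → ℝ} (hw : ∀ i, 0 < w i)
    {o : M → N} (ho : IsClean (Likes I) o) (hv : ∀ g i, ¬ IsViolation (Likes I) w o g i)
    {g : M} (hg : Likes I g (o g)) (i : N) :
    (I.bundleVal i ((allocationOf o).bundle (o g) \ {g}) : ℝ) / w (o g) ≤
      (I.bundleVal i ((allocationOf o).bundle i) : ℝ) / w i := by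
  classical
  by_cases h0 : I.bundleVal i ((allocationOf o).bundle (o g) \ {g}) = 0
  · rw [h0, Nat.cast_zero, zero_div]
    exact div_nonneg (Nat.cast_nonneg _) (hw i).le
  have h1 : ∃ h, o h = o g ∧ Likes I h i := by
    rw [bundleVal_eq_card hb, Finset.card_eq_zero, ← ne_eq, ← Finset.nonempty_iff_ne_empty] at h0
    obtain ⟨h, hh⟩ := h0
    simp only [Finset.mem_filter, Finset.mem_sdiff, mem_allocationOf] at hh
    exact ⟨h, hh.1.1, hh.2⟩
  obtain ⟨h, hhg, hh⟩ := h1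
  -- The absence of violations is used for an item `h` that `i` likes; the removed item `g` need not
  -- be liked by `i`.
  have h2 := hv h i
  rw [IsViolation, not_and, not_and, not_lt, hhg] at h2
  have h3 := h2 hh (hhg ▸ ho h i hh)
  rw [bundleVal_allocationOf hb]
  refine le_trans (div_le_div_of_nonneg_right ?_ (hw _).le) h3
  -- By cleanness, the owner also likes whatever `i` likes in the bundle, and in addition likes `g`.
  have h4 : I.bundleVal i ((allocationOf o).bundle (o g) \ {g}) + 1 ≤
      valuedCount (Likes I) o (o g) := by
    rw [bundleVal_eq_card hb, valuedCount]
    rw [← Finset.card_insert_of_notMem (a := g) (by simp)]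
    refine Finset.card_le_card fun k hk => ?_
    simp only [Finset.mem_insert, Finset.mem_filter, Finset.mem_sdiff, mem_allocationOf,
      Finset.mem_univ, true_and] at hk ⊢
    rcases hk with rfl | hk
    · exact ⟨rfl, hg⟩
    · exact ⟨hk.1.1, hk.1.1 ▸ ho k i hk.2⟩
  have h5 : ((I.bundleVal i ((allocationOf o).bundle (o g) \ {g}) + 1 : ℕ) : ℝ) ≤
      (valuedCount (Likes I) o (o g) : ℝ) := Nat.cast_le.2 h4
  push_cast at h5
  linarith

/-- If an agent likes nothing in its own bundle, cleanness shows that nobody does, and any item may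
be removed. -/
theorem isSWEF1_allocationOf [Fintype N] [Nonempty M] (hb : I.IsBinary) {w : N → ℝ}
    (hw : ∀ i, 0 < w i) {o : M → N} (ho : IsClean (Likes I) o)
    (hv : ∀ g i, ¬ IsViolation (Likes I) w o g i) : IsSWEF1 I w (allocationOf o) := by
  classical
  intro j
  by_cases h : ∃ g, o g = j ∧ Likes I g j
  · obtain ⟨g, rfl, hg⟩ := h
    exact ⟨g, fun i => bundleVal_sdiff_le hb hw ho hv hg i⟩
  · refine ⟨Classical.arbitrary M, fun i => ?_⟩
    have h0 : I.bundleVal i ((allocationOf o).bundle j \ {Classical.arbitrary M}) = 0 := by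
      rw [bundleVal_eq_card hb, Finset.card_eq_zero, Finset.filter_eq_empty_iff]
      intro g hg hi
      rw [Finset.mem_sdiff, mem_allocationOf] at hg
      exact h ⟨g, hg.1, hg.1 ▸ ho g i hi⟩
    rw [h0, Nat.cast_zero, zero_div]
    exact div_nonneg (Nat.cast_nonneg _) (hw i).le

/-- The fairness notion takes the weights into account. -/
def FairnessNotion.isWeighted : FairnessNotion → Bool
  | .wEF1 => true
  | .swEF1 => true
  | _ => false

theorem isFair_allocationOf [Fintype N] [Nonempty M] (F : FairnessNotion) (hb : I.IsBinary)
    {w : N → ℝ} (hw : ∀ i, 0 < w i) {o : M → N} (ho : IsClean (Likes I) o)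
    (hv : ∀ g i, ¬ IsViolation (Likes I) (if F.isWeighted then w else fun _ => 1) o g i) :
    IsFair F I w (allocationOf o) := by
  classical
  cases F with
  | swEF1 => exact isSWEF1_allocationOf hb hw ho hv
  | wEF1 =>
    intro i j
    obtain ⟨g, hg⟩ := isSWEF1_allocationOf hb hw ho hv j
    exact ⟨g, hg i⟩
  | sEF1 =>
    intro j
    obtain ⟨g, hg⟩ := isSWEF1_allocationOf hb (fun _ => one_pos) ho hv j
    exact ⟨g, fun i => by simpa using hg i⟩
  | EF1 =>
    intro i j
    obtain ⟨g, hg⟩ := isSWEF1_allocationOf hb (fun _ => one_pos) ho hv j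
    exact ⟨g, by simpa using hg i⟩
  | EFL =>
    intro i j
    by_cases h : (((allocationOf o).bundle j).filter fun g => 0 < I.val i g).card ≤ 1
    · exact Or.inl h
    · right
      rw [not_le, Finset.one_lt_card] at h
      obtain ⟨g, hg, g', hg', hne⟩ := h
      rw [Finset.mem_filter, mem_allocationOf] at hg hg'
      obtain ⟨rfl, hi⟩ := hg
      have h1 := bundleVal_sdiff_le hb (fun _ => one_pos) ho hv (ho g i hi) i
      rw [div_one, div_one, Nat.cast_le] at h1
      -- The second liked item `g'` survives the removal of `g`, so the remaining bundle is worth at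
      -- least 1, hence at least as much as `g`.
      refine ⟨g, mem_allocationOf.2 rfl, h1, le_trans ?_ h1⟩
      have h2 : I.bundleVal i {g'} ≤ I.bundleVal i ((allocationOf o).bundle (o g) \ {g}) := by
        refine Finset.sum_le_sum_of_subset (Finset.singleton_subset_iff.2 ?_)
        rw [Finset.mem_sdiff, mem_allocationOf, Finset.mem_singleton]
        exact ⟨hg'.1, hne.symm⟩
      refine le_trans ?_ h2
      rw [SocialImpactInstance.bundleVal, SocialImpactInstance.bundleVal, Finset.sum_singleton,
        Finset.sum_singleton]
      rcases hb i g with h | h <;> omega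
  | tEF1 =>
    intro i j hij
    have h0 : 0 < I.bundleVal i ((allocationOf o).bundle j) := by omega
    rw [bundleVal_eq_card hb, Finset.card_pos] at h0
    obtain ⟨g, hg⟩ := h0
    rw [Finset.mem_filter, mem_allocationOf] at hg
    obtain ⟨rfl, hi⟩ := hg
    have h1 := bundleVal_sdiff_le hb (fun _ => one_pos) ho hv (ho g i hi) i
    rw [div_one, div_one, Nat.cast_le] at h1
    -- The envy is gone after the removal alone; receiving `g` cannot hurt.
    exact ⟨g, mem_allocationOf.2 rfl, h1.trans
      (Finset.sum_le_sum_of_subset Finset.subset_union_left)⟩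

end Fairness

/-- Existence of fair allocations that maximize the social impact. -/
theorem exists_isSIM_isFair (F : FairnessNotion) {N M : Type*} [Fintype N] [Nonempty N] [Fintype M]
    [Nonempty M] [DecidableEq M] (I : SocialImpactInstance N M) (w : N → ℝ) (hw : ∀ i, 0 < w i)
    (hb : I.IsBinary) (he : I.ValEqImpact) : ∃ A : Allocation N M, IsSIM I A ∧ IsFair F I w A := by
  obtain ⟨o, ho, hv⟩ := exists_isClean_forall_not_isViolation (Likes I)
    (w := if F.isWeighted then w else fun _ => 1) (by split <;> simp [hw])
  exact ⟨allocationOf o, isSIM_allocationOf hb he ho, isFair_allocationOf F hb hw ho hv⟩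

/-! ### Input and output of words -/

/-- The number of a symbol in the list of all symbols. -/
def symCode : Γ' → ℕ
  | .bit false => 0
  | .bit true => 1
  | .ket => 2
  | .comma => 3
  | .blank => 4
  | .bra => 5

/-- All symbols. -/
def allSyms : List Γ' := [.bit false, .bit true, .ket, .comma, .blank, .bra]

theorem getElem?_allSyms (s : Γ') : allSyms[symCode s]? = some s := by
  rcases s with _ | b | _ | _ | _ <;> first | rfl | (cases b <;> rfl)

instance : TreeEnc Γ' := ⟨fun s => TreeEnc.enc (symCode s)⟩

theorem symCode_le (s : Γ') : symCode s ≤ 5 := by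
  rcases s with _ | b | _ | _ | _ <;> first | decide | (cases b <;> decide)

theorem sz_sym_le (s : Γ') : sz s ≤ 11 := by
  change sz (symCode s) ≤ 11
  rw [sz_nat]
  have := symCode_le s
  omega

namespace Prog

/-- Push a word on stack `0`. -/
def pushWord : List Γ' → Prog
  | [] => .seq (.push 0 .blank) (.pop 0)
  | c :: l => .seq (pushWord l) (.push 0 c)

/-- Run a program that depends on the current symbol. -/
def dispatch (f : Γ' → Prog) : List Γ' → Prog
  -- An arbitrary program, never reached when the symbol occurs in the list.
  | [] => .pop 1
  | s :: l => .ite (fun v => v == some s) (f s) (dispatch f l)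

/-- Encode the word on stack `1`, in reverse order, on stack `0`. -/
def readWord : Prog :=
  .seq (.push 0 .ket) (.seq (.pop 1) (.loop (fun v => v.isSome)
    (.seq (dispatch (fun s => pushWord (.bra :: wd s)) allSyms) (.pop 1))))

/-- Decode the symbol on top of stack `0` and push it on stack `2`. -/
def writeSym : List Γ' → Prog
  | [] => .pop 1
  | s :: l => .seq (.pop 0) (.ite (fun v => v == some .ket) (.push 2 s)
      (.seq (.pop 0) (writeSym l)))

/-- Decode the list on stack `0` and push it on stack `2`. -/
def writeWord : Prog :=
  .seq (.pop 0) (.loop (fun v => v == some .bra) (.seq (writeSym allSyms) (.pop 0)))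

end Prog

theorem spec_pushWord (l d a b c : List Γ') :
    Spec (.pushWord l) ![d, a, b, c] ![l ++ d, a, b, c] (l.length + 2) := by
  induction l with
  | nil => exact fun v => ⟨2, by simp, _, (Exec.push_zero _ _ _ _ _ _).seq
      (Exec.pop_zero _ _ _ _ _)⟩
  | cons x l ih =>
    refine (ih.seq (N := l.length + 2) (M := 1) fun v => ⟨1, le_rfl, v,
      Exec.push_zero _ _ _ _ _ _⟩).mono (by simp)

theorem exec_dispatch {f : Γ' → Prog} {l : List Γ'} {s : Γ'} (hs : s ∈ l) {S S' N}
    (h : Spec (f s) S S' N) :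
    ∃ n ≤ N + l.length, ∃ v', Exec (.dispatch f l) (some s) S n v' S' := by
  induction l with
  | nil => simp at hs
  | cons t l ih =>
    by_cases hst : s = t
    · subst hst
      obtain ⟨n, hn, v', h⟩ := h (some s)
      exact ⟨n + 1, by simp; omega, v', Exec.iteTrue (by simp) h⟩
    · obtain ⟨n, hn, v', h⟩ := ih ((List.mem_cons.1 hs).resolve_left hst)
      exact ⟨n + 1, by simp; omega, v', Exec.iteFalse (by simp [hst]) h⟩

theorem spec_readWord (w b c : List Γ') :
    Spec .readWord ![[], w, b, c] ![wd w.reverse, [], b, c] (30 * w.length + 10) := by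
  have key : ∀ (w acc : List Γ'), ∃ n ≤ 30 * w.length + 1, ∃ v',
      Exec (.loop (fun v => v.isSome)
        (.seq (.dispatch (fun s => .pushWord (.bra :: wd s)) allSyms) (.pop 1))) w.head?
        ![wd acc, w.tail, b, c] n v' ![wd (w.reverse ++ acc), [], b, c] := by
    intro w
    induction w with
    | nil => exact fun acc => ⟨1, by simp, _, Exec.loopDone rfl⟩
    | cons s w ih =>
      intro acc
      obtain ⟨n, hn, v', h⟩ := ih (s :: acc)
      obtain ⟨m, hm, v'', h2⟩ := exec_dispatch (List.mem_of_getElem? (getElem?_allSyms s))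
        (f := fun s => .pushWord (.bra :: wd s)) (spec_pushWord (.bra :: wd s) (wd acc) w b c)
      refine ⟨(m + 1) + n + 1, ?_, v', Exec.loopStep rfl (h2.seq (Exec.pop_one _ _ _ _ _)) ?_⟩
      · have := sz_sym_le s
        rw [List.length_cons, length_wd] at hm
        simp only [allSyms, List.length_cons, List.length_nil] at hm ⊢
        omega
      · simpa using h
  intro v
  obtain ⟨n, hn, v', h⟩ := key w []
  refine ⟨1 + (1 + n), by omega, v', ?_⟩
  have := (Exec.push_zero [] w b c .ket v).seq ((Exec.pop_one _ _ _ _ _).seq h)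
  rw [List.append_nil] at this
  exact this

/-- Each unit of the unary code is the pair `bra`, `ket`; removing it advances the list of symbols
by one, until the closing `ket` selects the symbol. -/
theorem spec_writeSym (l : List Γ') (s : Γ') (rest a b c : List Γ') : ∀ k : ℕ, l[k]? = some s →
    Spec (.writeSym l) ![wd k ++ rest, a, b, c] ![rest, a, s :: b, c] (4 * k + 4) := by
  induction l with
  | nil => intro k h; simp at h
  | cons t l ih =>
    intro k h v
    cases k with
    | zero =>
      simp only [List.getElem?_cons_zero, Option.some.injEq] at h
      subst h
      exact ⟨1 + (1 + 1), by omega, _, (Exec.pop_zero_cons _ _ _ _ .ket _).seq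
        (Exec.iteTrue rfl (Exec.push_two _ _ _ _ _ _))⟩
    | succ k =>
      obtain ⟨n, hn, v', h⟩ := ih k (by simpa using h) (some .ket)
      exact ⟨1 + ((1 + n) + 1), by omega, _, (Exec.pop_zero_cons _ _ _ _ .bra _).seq
        (Exec.iteFalse rfl ((Exec.pop_zero_cons _ _ _ _ .ket _).seq h))⟩

theorem spec_writeWord (w a c : List Γ') :
    Spec .writeWord ![wd w, a, [], c] ![[], a, w.reverse, c] (30 * w.length + 10) := by
  have key : ∀ (w b : List Γ'), ∃ n ≤ 30 * w.length + 1, ∃ v',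
      Exec (.loop (fun v => v == some .bra) (.seq (.writeSym allSyms) (.pop 0))) (wd w).head?
        ![(wd w).tail, a, b, c] n v' ![[], a, w.reverse ++ b, c] := by
    intro w
    induction w with
    | nil => exact fun b => ⟨1, by simp, _, Exec.loopDone rfl⟩
    | cons s w ih =>
      intro b
      obtain ⟨n, hn, v', h⟩ := ih (s :: b)
      obtain ⟨m, hm, v'', h2⟩ := spec_writeSym allSyms s (wd w) a b c (symCode s)
        (getElem?_allSyms s) (some .bra)
      refine ⟨(m + 1) + n + 1, ?_, v', Exec.loopStep rfl (h2.seq (Exec.pop_zero _ _ _ _ _)) ?_⟩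
      · have := symCode_le s
        simp only [List.length_cons]
        omega
      · simpa using h
  intro v
  obtain ⟨n, hn, v', h⟩ := key w []
  refine ⟨1 + n, by omega, v', ?_⟩
  have := (Exec.pop_zero (wd w) a [] c v).seq h
  rw [List.append_nil] at this
  exact this

/-- A polynomial time function on words, preceded and followed by any encoding as a word, is
computed by a Turing machine in polynomial time. -/
theorem PolyTime.computableInPolyTime {F : List Γ' → List Γ'} (hF : PolyTime F) {α : Type}
    (f g : α → List Γ') (h : ∀ a, g a = F (f a)) :
    Nonempty (TM2ComputableInPolyTime f (fun y : List Γ' => y) g) := by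
  -- Reading and writing each reverse the word, which the two reversals here undo.
  have hG := ((hF.comp (PolyTime.id (α := List Γ')).reverse).reverse)
  obtain ⟨L, hL⟩ := hG.length.size_bound
  obtain ⟨p, P, hp⟩ := hG
  refine Prog.computableInPolyTime (.seq .readWord (.seq p .writeWord))
    ((30 * Polynomial.X + 10) + (P.comp (12 * Polynomial.X + 1) +
      (30 * L.comp (12 * Polynomial.X + 1) + 10))) f g fun a => ?_
  have h1 := spec_readWord (f a) [] []
  have h2 := hp (f a).reverse []
  have h3 := spec_writeWord (F (f a)).reverse [] []
  simp only [List.append_nil, List.reverse_reverse] at h2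
  rw [List.reverse_reverse, ← h] at h3
  rw [← h] at h2
  obtain ⟨n, hn, hv⟩ := (h1.seq (h2.seq h3)) none
  refine ⟨n, hn.trans ?_, hv⟩
  have h4 : sz (f a).reverse ≤ 12 * (f a).length + 1 := by
    have := sz_list_le (l := (f a).reverse) (B := 11) fun s _ => sz_sym_le s
    rw [List.length_reverse] at this
    omega
  have h5 : (g a).reverse.length ≤ L.eval (sz (f a).reverse) := by
    have h6 : sz ((F (f a).reverse.reverse).reverse.length) ≤ _ := hL (f a).reverse
    rw [sz_nat, List.reverse_reverse, ← h] at h6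
    omega
  have h7 := polynomial_eval_mono P h4
  have h8 := polynomial_eval_mono L h4
  simp only [Polynomial.eval_add, Polynomial.eval_mul, Polynomial.eval_X, Polynomial.eval_ofNat,
    Polynomial.eval_comp, Polynomial.eval_one]
  omega

/-! ### The algorithm -/

/-- The parsed input: the list of numerators and denominators of the weights, and for every item
the list of values and social impacts. -/
abbrev Table := List (List Bool) × List (List (List Bool))

/-- A step of the parser. -/
def parseStep (st : List Bool × List (List Bool) × List (List (List Bool))) (s : Γ') :
    List Bool × List (List Bool) × List (List (List Bool)) :=
  -- The state consists of the bits of the current number, the numbers of the current row and the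
  -- finished rows, each latest first. A comma ends a number, a `ket` ends a row.
  if (symCode s == 0) = true then (false :: st.1, st.2)
  else if (symCode s == 1) = true then (true :: st.1, st.2)
  else if (symCode s == 2) = true then ([], [], st.2.1.reverse :: st.2.2)
  else if (symCode s == 3) = true then ([], st.1.reverse :: st.2.1, st.2.2)
  else st

/-- The parser. -/
def parse (w : List Γ') : Table :=
  let r := (w.foldl parseStep ([], [], [])).2.2.reverse
  (r.headD [], r.tail)

/-- Replace all weights by `1`, unless they are to be taken into account. -/
def setWeights (b : Bool) (c : Table) : Table :=
  if b = true then c else (c.1.map fun _ => [true], c.2)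

namespace Table

/-- The number of items. -/
def numItems (c : Table) : ℕ := c.2.length

/-- The number of agents. -/
def numAgents (c : Table) : ℕ :=
  -- An agent has two entries, numerator and denominator, so only every second entry counts.
  (c.1.foldl (fun (s : Bool × ℕ) _ => if s.1 = true then (false, s.2 + 1) else (true, s.2))
    (false, 0)).2

/-- The numerator of the weight of agent `i`. -/
def num (c : Table) (i : ℕ) : List Bool := c.1.getD (i + i) []

/-- The denominator of the weight of agent `i`. -/
def den (c : Table) (i : ℕ) : List Bool := c.1.getD (i + i + 1) []

/-- Agent `i` has a positive value for item `g`. -/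
def likes (c : Table) (g i : ℕ) : Bool := !((c.2.getD g []).getD (i + i) []).isEmpty

/-- The number of items that are owned and liked by agent `j`. -/
def count (c : Table) (o : List ℕ) (j : ℕ) : List Bool :=
  (List.range c.numItems).foldl
    (fun b g => if (o.getD g 0 == j && c.likes g j) = true then addBits b [true] else b) []

/-- Agent `i` should get item `g` from its owner. -/
def violates (c : Table) (o : List ℕ) (g i : ℕ) : Bool :=
  (c.likes g i && c.likes g (o.getD g 0)) &&
    -- The inequality of `IsViolation`, multiplied by the denominators and with the subtracted term
    -- moved to the left, so that it stays within the natural numbers.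
    ltBits (addBits (mulBits (c.count o i) (mulBits (c.den i) (c.num (o.getD g 0))))
      (mulBits (c.den (o.getD g 0)) (c.num i)))
      (mulBits (c.count o (o.getD g 0)) (mulBits (c.den (o.getD g 0)) (c.num i)))

/-- Give item `x.1` to agent `x.2` if the agent should get it. -/
def move (c : Table) (o : List ℕ) (x : ℕ × ℕ) : List ℕ :=
  if c.violates o x.1 x.2 = true then
    (List.range c.numItems).map fun h => if (h == x.1) = true then x.2 else o.getD h 0
  else o

/-- All pairs of an item and an agent. -/
def pairs (c : Table) : List (ℕ × ℕ) :=
  (List.range c.numItems).flatMap fun g => (List.range c.numAgents).map fun i => (g, i)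

/-- A list with as many elements as there are sweeps of the local search. -/
def rounds (c : Table) : List ℕ :=
  -- The length |M|²|N| is the bound on the potential.
  (List.range c.numItems).flatMap fun _ => (List.range c.numItems).flatMap fun _ =>
    List.range c.numAgents

/-- An initial assignment. -/
def initial (c : Table) : List ℕ :=
  (List.range c.numItems).map fun g =>
    (List.range c.numAgents).foldl (fun b i => if c.likes g i = true then i else b) 0

/-- The local search. -/
def search (c : Table) : List ℕ :=
  (c.rounds.flatMap fun _ => c.pairs).foldl c.move c.initial

/-- The word that describes an assignment. -/
def output (c : Table) (o : List ℕ) : List Γ' :=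
  (List.range c.numItems).flatMap fun g =>
    ((List.range c.numAgents).map fun i => if (o.getD g 0 == i) = true then Γ'.bit true
      else Γ'.bit false) ++ [Γ'.ket]

end Table

/-- The algorithm as a function on words. -/
def solve (b : Bool) (w : List Γ') : List Γ' :=
  (setWeights b (parse w)).output (setWeights b (parse w)).search

/-! ### Running time of the algorithm. -/

namespace PolyTime

variable {γ : Type} [TreeEnc γ]

theorem sz_reverse {α : Type} [TreeEnc α] (l : List α) : sz l.reverse = sz l := by
  induction l with
  | nil => rfl
  | cons a l ih =>
    have := sz_append l.reverse [a]
    rw [List.reverse_cons]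
    simp at this ⊢
    omega

theorem parseStep :
    PolyTime fun p : γ × (List Bool × List (List Bool) × List (List (List Bool))) × Γ' =>
      parseStep p.2.1 p.2.2 := by
  let P := γ × (List Bool × List (List Bool) × List (List (List Bool))) × Γ'
  have s : PolyTime fun p : P => symCode p.2.2 :=
    comp (g := symCode) (of_wd_eq fun _ => rfl) (snd.comp snd)
  have st : PolyTime fun p : P => p.2.1 := fst.comp snd
  have a : PolyTime fun p : P => p.2.1.1 := fst.comp st
  have b : PolyTime fun p : P => p.2.1.2 := snd.comp st
  have b1 : PolyTime fun p : P => p.2.1.2.1 := fst.comp b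
  have b2 : PolyTime fun p : P => p.2.1.2.2 := snd.comp b
  exact ite (s.nat_beq (const 0)) (((const false).cons a).pair b)
    (ite (s.nat_beq (const 1)) (((const true).cons a).pair b)
    (ite (s.nat_beq (const 2)) ((const []).pair ((const []).pair (b1.reverse.cons b2)))
    (ite (s.nat_beq (const 3)) ((const []).pair ((a.reverse.cons b1).pair b2)) st)))

theorem parse : PolyTime parse := by
  have h := foldl_of_size (γ := List Γ') (l := fun w => w) (i := fun _ => ([], [], []))
    (s := fun p => FairDivision.parseStep p.2.1 p.2.2) parseStep PolyTime.id (const _) (.const 10) (fun c b a _ => by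
      obtain ⟨x, y, z⟩ := b
      simp only [FairDivision.parseStep]
      have := sz_bool_le true
      have := sz_bool_le false
      have := sz_pos x
      have := sz_pos y
      split_ifs <;> simp [sz_reverse] <;> omega)
  have r := (snd.comp (snd.comp h)).reverse
  exact (r.headD []).pair r.tail

theorem setWeights (b : Bool) : PolyTime (setWeights b) := by
  cases b
  · exact (map (γ := Table) (g := fun _ => [true]) (const [true]) fst).pair snd
  · exact PolyTime.id

variable {c : γ → Table} {o : γ → List ℕ} {g i : γ → ℕ}

theorem numItems (hc : PolyTime c) : PolyTime fun x => (c x).numItems := (snd.comp hc).length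

theorem numAgents (hc : PolyTime c) : PolyTime fun x => (c x).numAgents := by
  let P := γ × (Bool × ℕ) × List Bool
  have b : PolyTime fun p : P => p.2.1.1 := fst.comp (fst.comp snd)
  have k : PolyTime fun p : P => p.2.1.2 := snd.comp (fst.comp snd)
  have h := foldl_of_size (s := fun p : P =>
      if p.2.1.1 = true then (false, p.2.1.2 + 1) else (true, p.2.1.2)) (i := fun _ => (false, 0))
    (ite b ((const false).pair k.succ) ((const true).pair k)) (fst.comp hc) (const _) (.const 10)
    (fun c b a _ => by
      obtain ⟨b, k⟩ := b
      have := sz_bool_le true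
      have := sz_bool_le false
      cases b <;> simp [sz_nat] <;> omega)
  exact snd.comp h

theorem num (hc : PolyTime c) (hi : PolyTime i) : PolyTime fun x => (c x).num (i x) :=
  (fst.comp hc).getD (hi.nat_add hi) _

theorem den (hc : PolyTime c) (hi : PolyTime i) : PolyTime fun x => (c x).den (i x) :=
  (fst.comp hc).getD (hi.nat_add hi).succ _

theorem likes (hc : PolyTime c) (hg : PolyTime g) (hi : PolyTime i) :
    PolyTime fun x => (c x).likes (g x) (i x) :=
  (((snd.comp hc).getD hg []).getD (hi.nat_add hi) []).isEmpty.not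

theorem count (hc : PolyTime c) (ho : PolyTime o) (hi : PolyTime i) :
    PolyTime fun x => (c x).count (o x) (i x) := by
  have g : PolyTime fun p : γ × List Bool × ℕ => p.2.2 := snd.comp snd
  have b : PolyTime fun p : γ × List Bool × ℕ => p.2.1 := fst.comp snd
  exact foldl_of_measure (s := fun p => if ((o p.1).getD p.2.2 0 == i p.1 &&
      (c p.1).likes p.2.2 (i p.1)) = true then FairDivision.addBits p.2.1 [true] else p.2.1)
    (ite ((((ho.comp fst).getD g 0).nat_beq (hi.comp fst)).and
      (likes (hc.comp fst) g (hi.comp fst))) (b.addBits (const _)) b)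
    hc.numItems.range (const []) List.length (.const 2) (fun _ => by simp)
    (fun c b a _ => by simp only; split_ifs <;> simp [length_addBits]) sz_bits_le

theorem violates (hc : PolyTime c) (ho : PolyTime o) (hg : PolyTime g) (hi : PolyTime i) :
    PolyTime fun x => (c x).violates (o x) (g x) (i x) := by
  have hj := ho.getD hg 0
  exact ((likes hc hg hi).and (likes hc hg hj)).and
    ((((count hc ho hi).mulBits ((den hc hi).mulBits (num hc hj))).addBits
      ((den hc hj).mulBits (num hc hi))).ltBits
      ((count hc ho hj).mulBits ((den hc hj).mulBits (num hc hi))))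

theorem move {x : γ → ℕ × ℕ} (hc : PolyTime c) (ho : PolyTime o) (hx : PolyTime x) :
    PolyTime fun y => (c y).move (o y) (x y) := by
  have hg := fst.comp hx
  have hi := snd.comp hx
  refine ite (violates hc ho hg hi) (map (g := fun p : γ × ℕ =>
    if (p.2 == (x p.1).1) = true then (x p.1).2 else (o p.1).getD p.2 0) ?_ hc.numItems.range) ho
  exact ite (snd.nat_beq (hg.comp fst)) (hi.comp fst) ((ho.comp fst).getD snd 0)

theorem pairs (hc : PolyTime c) : PolyTime fun x => (c x).pairs :=
  flatMap (g := fun p : γ × ℕ => (List.range (c p.1).numAgents).map fun i => (p.2, i))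
    (map (g := fun p : (γ × ℕ) × ℕ => (p.1.2, p.2)) ((snd.comp fst).pair snd)
      (hc.comp fst).numAgents.range) hc.numItems.range

theorem rounds (hc : PolyTime c) : PolyTime fun x => (c x).rounds :=
  flatMap (g := fun p : γ × ℕ => (List.range (c p.1).numItems).flatMap fun _ =>
      List.range (c p.1).numAgents)
    (flatMap (g := fun p : (γ × ℕ) × ℕ => List.range (c p.1.1).numAgents)
      (hc.comp (fst.comp fst)).numAgents.range (hc.comp fst).numItems.range) hc.numItems.range

theorem initial (hc : PolyTime c) : PolyTime fun x => (c x).initial := by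
  refine map (g := fun p : γ × ℕ => (List.range (c p.1).numAgents).foldl
    (fun b i => if (c p.1).likes p.2 i = true then i else b) 0) ?_ hc.numItems.range
  let P := (γ × ℕ) × ℕ × ℕ
  have i : PolyTime fun p : P => p.2.2 := snd.comp snd
  have h := (hc.comp (fst (β := ℕ)))
  exact foldl_of_invariant
    (s := fun p : P => if (c p.1.1).likes p.1.2 p.2.2 = true then p.2.2 else p.2.1)
    (ite (likes (hc.comp (fst.comp fst)) (snd.comp fst) i) i (fst.comp snd)) h.numAgents.range
    (const 0) (fun p b => b ≤ (c p.1).numAgents) (fun _ => Nat.zero_le _)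
    (fun p b a ha hb => by
      have := List.mem_range.1 ha
      simp only
      split_ifs <;> omega)
    h.numAgents.size_bound (fun p b hb => by rw [sz_nat, sz_nat]; omega)

/-- An assignment of a table has an entry for every item, and no entry is too large. -/
def _root_.FairDivision.Table.IsAssignment (c : Table) (o : List ℕ) : Prop :=
  o.length = c.numItems ∧ ∀ a ∈ o, a ≤ c.numAgents

/-- Running times are bounded on all words, including malformed ones. The bound on the entries is
not strict because the default owner 0 must be admitted even if there are no agents. -/
theorem _root_.FairDivision.Table.isAssignment_initial (c : Table) :
    c.IsAssignment c.initial := by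
  refine ⟨by simp [Table.initial], fun a ha => ?_⟩
  obtain ⟨g, _, rfl⟩ := List.mem_map.1 ha
  have key : ∀ (l : List ℕ) (b : ℕ), (∀ a ∈ l, a ≤ c.numAgents) → b ≤ c.numAgents →
      l.foldl (fun b i => if c.likes g i = true then i else b) b ≤ c.numAgents := by
    intro l
    induction l with
    | nil => exact fun b _ h => h
    | cons a l ih =>
      refine fun b h hb => ih _ (fun x hx => h x (List.mem_cons_of_mem _ hx)) ?_
      simp only
      split_ifs
      · exact h a List.mem_cons_self
      · exact hb
  exact key _ _ (fun a ha => (List.mem_range.1 ha).le) (Nat.zero_le _)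

theorem _root_.FairDivision.Table.IsAssignment.move {c : Table} {o : List ℕ}
    (h : c.IsAssignment o) {x : ℕ × ℕ} (hx : x ∈ c.pairs) : c.IsAssignment (c.move o x) := by
  rw [Table.move]
  split_ifs
  · refine ⟨by simp, fun a ha => ?_⟩
    obtain ⟨k, _, rfl⟩ := List.mem_map.1 ha
    split_ifs
    · obtain ⟨g, _, hg⟩ := List.mem_flatMap.1 hx
      obtain ⟨i, hi, rfl⟩ := List.mem_map.1 hg
      exact (List.mem_range.1 hi).le
    · rw [List.getD_eq_getElem?_getD]
      rcases hk : o[k]? with _ | a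
      · exact Nat.zero_le _
      · exact h.2 a (List.mem_of_getElem? hk)
  · exact h

/-- Every intermediate assignment has one entry per item, bounded by the number of agents, so its
unary encoding has polynomial size. -/
theorem search (hc : PolyTime c) : PolyTime fun x => (c x).search := by
  refine foldl_of_invariant (s := fun p : γ × List ℕ × (ℕ × ℕ) => (c p.1).move p.2.1 p.2.2)
    (move (hc.comp fst) (fst.comp snd) (snd.comp snd))
    (flatMap (g := fun p : γ × ℕ => (c p.1).pairs) (pairs (hc.comp fst)) (rounds hc))
    (initial hc) (fun x o => (c x).IsAssignment o) (fun x => (c x).isAssignment_initial) ?_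
    ((hc.numItems.size_bound.mul ((hc.numAgents.size_bound.mul (.const 2)).add (.const 2))).add
      (.const 1)) ?_
  · intro x o a ha ho
    obtain ⟨_, _, ha⟩ := List.mem_flatMap.1 ha
    exact ho.move ha
  · rintro x o ⟨h1, h2⟩
    have h3 := sz_list_le (l := o) (B := 2 * (c x).numAgents + 1) fun a ha => by
      have := h2 a ha
      rw [sz_nat]
      omega
    refine h3.trans (Nat.add_le_add_right (Nat.mul_le_mul ?_ ?_) 1) <;> simp only [sz_nat] <;> omega

theorem output (hc : PolyTime c) (ho : PolyTime o) : PolyTime fun x => (c x).output (o x) :=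
  flatMap (g := fun p : γ × ℕ => ((List.range (c p.1).numAgents).map fun i =>
      if ((o p.1).getD p.2 0 == i) = true then Γ'.bit true else Γ'.bit false) ++ [Γ'.ket])
    (append (map (g := fun p : (γ × ℕ) × ℕ =>
        if ((o p.1.1).getD p.1.2 0 == p.2) = true then Γ'.bit true else Γ'.bit false)
      (ite (((ho.comp (fst.comp fst)).getD (snd.comp fst) 0).nat_beq snd) (const _) (const _))
      (hc.comp fst).numAgents.range) (const _)) hc.numItems.range

theorem solve (b : Bool) : PolyTime (solve b) :=
  have h := (setWeights b).comp parse
  h.output h.search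

end PolyTime

/-! ### Correctness of the local search -/

namespace Table

/-- The table `c` describes the agents `Fin n` with weights `w` and the items `Fin m`. -/
structure Represents (c : Table) {n m : ℕ} (L : Fin m → Fin n → Prop) (w : Fin n → ℝ) : Prop where
  numItems : c.numItems = m
  numAgents : c.numAgents = n
  likes : ∀ (g : Fin m) (i : Fin n), c.likes g i = true ↔ L g i
  num_pos : ∀ i : Fin n, 0 < bitsVal (c.num i)
  den_pos : ∀ i : Fin n, 0 < bitsVal (c.den i)
  weight : ∀ i : Fin n, w i = (bitsVal (c.num i) : ℝ) / bitsVal (c.den i)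

/-- The list of the owners of all items. -/
def owners {n m : ℕ} (f : Fin m → Fin n) : List ℕ := List.ofFn fun g => (f g : ℕ)

theorem getD_owners {n m : ℕ} (f : Fin m → Fin n) (g : Fin m) : (owners f).getD g 0 = f g := by
  simp [owners, List.getD_eq_getElem?_getD]

theorem owners_eq_map_range {n m : ℕ} (f : Fin m → Fin n) (h : ℕ → ℕ)
    (hf : ∀ g : Fin m, h g = f g) : (List.range m).map h = owners f := by
  refine List.ext_getElem (by simp [owners]) fun k h1 h2 => ?_
  have hk : k < m := by simpa using h1
  simpa [owners] using hf ⟨k, hk⟩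

variable {c : Table} {n m : ℕ} {L : Fin m → Fin n → Prop} {w : Fin n → ℝ}

theorem Represents.weight_pos (h : c.Represents L w) (i : Fin n) : 0 < w i := by
  rw [h.weight]
  exact div_pos (Nat.cast_pos.2 (h.num_pos i)) (Nat.cast_pos.2 (h.den_pos i))

theorem Represents.bitsVal_count (h : c.Represents L w) (f : Fin m → Fin n) (j : Fin n) :
    bitsVal (c.count (owners f) j) = valuedCount L f j := by
  classical
  have key : ∀ k, bitsVal ((List.range k).foldl (fun b g =>
      if ((owners f).getD g 0 == (j : ℕ) && c.likes g j) = true then addBits b [true] else b) []) =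
      ∑ g ∈ Finset.range k,
        if ((owners f).getD g 0 == (j : ℕ) && c.likes g j) = true then 1 else 0 := by
    intro k
    induction k with
    | zero => rfl
    | succ k ih =>
      rw [List.range_succ, List.foldl_append, List.foldl_cons, List.foldl_nil,
        Finset.sum_range_succ, ← ih]
      split_ifs
      · rw [bitsVal_addBits]; rfl
      · rfl
  rw [count, key, h.numItems, Finset.sum_range, valuedCount, Finset.card_filter]
  refine Finset.sum_congr rfl fun g _ => ?_
  rw [getD_owners]
  congr 1
  rw [Bool.and_eq_true, h.likes, beq_iff_eq, Fin.val_inj]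

theorem Represents.violates_iff (h : c.Represents L w) (f : Fin m → Fin n) (g : Fin m)
    (i : Fin n) : c.violates (owners f) g i = true ↔ IsViolation L w f g i := by
  have hi := h.weight_pos i
  have hj := h.weight_pos (f g)
  have p1 : (0 : ℝ) < bitsVal (c.num i) := Nat.cast_pos.2 (h.num_pos i)
  have p2 : (0 : ℝ) < bitsVal (c.den i) := Nat.cast_pos.2 (h.den_pos i)
  have p3 : (0 : ℝ) < bitsVal (c.num (f g)) := Nat.cast_pos.2 (h.num_pos _)
  have p4 : (0 : ℝ) < bitsVal (c.den (f g)) := Nat.cast_pos.2 (h.den_pos _)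
  rw [violates, getD_owners, ltBits_eq, bitsVal_addBits]
  simp only [bitsVal_mulBits]
  rw [h.bitsVal_count, h.bitsVal_count, Bool.and_eq_true, Bool.and_eq_true, h.likes, h.likes,
    decide_eq_true_iff, IsViolation, and_assoc]
  refine and_congr Iff.rfl (and_congr Iff.rfl ?_)
  rw [div_lt_div_iff₀ hi hj, h.weight i, h.weight (f g), ← Nat.cast_lt (α := ℝ)]
  push_cast
  rw [← mul_div_assoc, ← mul_div_assoc, div_lt_div_iff₀ p4 p2, ← sub_pos,
    ← sub_pos (a := _ * _ * _)]
  -- Once denominators are cleared, both inequalities say that one and the same expression is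
  -- positive.
  have : ∀ a b : ℝ, a = b → (0 < a ↔ 0 < b) := fun a b e => by rw [e]
  exact this _ _ (by ring)

open scoped Classical in
theorem Represents.move_eq (h : c.Represents L w) (f : Fin m → Fin n) (g : Fin m) (i : Fin n) :
    c.move (owners f) (g, i) =
      owners (if IsViolation L w f g i then Function.update f g i else f) := by
  rw [move]
  by_cases hv : IsViolation L w f g i
  · rw [if_pos ((h.violates_iff f g i).2 hv), if_pos hv, h.numItems]
    refine owners_eq_map_range _ _ fun k => ?_
    rw [getD_owners]
    by_cases hk : k = g
    · subst hk; simp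
    · simp [hk, Fin.val_inj]
  · rw [if_neg (mt (h.violates_iff f g i).1 hv), if_neg hv]

theorem Represents.mem_pairs (h : c.Represents L w) {x : ℕ × ℕ} :
    x ∈ c.pairs ↔ ∃ (g : Fin m) (i : Fin n), x = (↑g, ↑i) := by
  rw [pairs, h.numItems, h.numAgents]
  simp only [List.mem_flatMap, List.mem_range, List.mem_map]
  constructor
  · rintro ⟨g, hg, i, hi, rfl⟩
    exact ⟨⟨g, hg⟩, ⟨i, hi⟩, rfl⟩
  · rintro ⟨g, i, rfl⟩
    exact ⟨g, g.2, i, i.2, rfl⟩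

/-- A sweep makes the potential smaller, unless there is no violation. -/
theorem Represents.foldl_move (h : c.Represents L w) (l : List (ℕ × ℕ))
    (hl : ∀ x ∈ l, ∃ (g : Fin m) (i : Fin n), x = (↑g, ↑i)) :
    ∀ f : Fin m → Fin n, IsClean L f → ∃ f', l.foldl c.move (owners f) = owners f' ∧
      IsClean L f' ∧ (potential L w f' < potential L w f ∨
        f' = f ∧ ∀ (g : Fin m) (i : Fin n), ((g : ℕ), (i : ℕ)) ∈ l → ¬ IsViolation L w f g i) := by
  classical
  induction l with
  | nil => exact fun f hf => ⟨f, rfl, hf, Or.inr ⟨rfl, by simp⟩⟩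
  | cons x l ih =>
    intro f hf
    obtain ⟨g, i, rfl⟩ := hl x List.mem_cons_self
    rw [List.foldl_cons, h.move_eq]
    have ih := ih fun y hy => hl y (List.mem_cons_of_mem _ hy)
    by_cases hv : IsViolation L w f g i
    · rw [if_pos hv]
      have hf' : IsClean L (Function.update f g i) := by convert hf.update hv.1
      have h4 : potential L w (Function.update f g i) < potential L w f := by
        convert potential_update_lt h.weight_pos hv
      obtain ⟨f', h1, h2, h3⟩ := ih _ hf'
      refine ⟨f', h1, h2, Or.inl ?_⟩
      rcases h3 with h3 | ⟨rfl, -⟩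
      · exact h3.trans h4
      · exact h4
    · rw [if_neg hv]
      obtain ⟨f', h1, h2, h3⟩ := ih f hf
      refine ⟨f', h1, h2, h3.imp_right fun h3 => ⟨h3.1, fun g' i' hm => ?_⟩⟩
      rcases List.mem_cons.1 hm with e | hm
      · obtain ⟨e1, e2⟩ := Prod.mk.inj e
        rwa [Fin.ext e1, Fin.ext e2]
      · exact h3.2 g' i' hm

/-- A sweep either lowers the potential or changes nothing and certifies that no violation is left;
in the latter case all further sweeps are idle. At potential 0 no transfer is possible. -/
theorem Represents.iterate_sweep (h : c.Represents L w) (k : ℕ) : ∀ f : Fin m → Fin n,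
    IsClean L f → potential L w f ≤ k → ∃ f',
      (fun o => c.pairs.foldl c.move o)^[k] (owners f) = owners f' ∧
      IsClean L f' ∧ ∀ g i, ¬ IsViolation L w f' g i := by
  induction k with
  | zero =>
    intro f hf hp
    refine ⟨f, rfl, hf, fun g i hv => ?_⟩
    have := potential_update_lt h.weight_pos hv
    omega
  | succ k ih =>
    intro f hf hp
    obtain ⟨f', h1, h2, h3⟩ := h.foldl_move c.pairs (fun x hx => h.mem_pairs.1 hx) f hf
    rw [Function.iterate_succ_apply]
    rcases h3 with h3 | ⟨rfl, h3⟩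
    · rw [h1]
      exact ih f' h2 (by omega)
    · refine ⟨f', ?_, h2, fun g i => h3 g i (h.mem_pairs.2 ⟨g, i, rfl⟩)⟩
      rw [h1]
      exact Function.iterate_fixed h1 k

theorem Represents.exists_initial [NeZero n] (h : c.Represents L w) :
    ∃ f : Fin m → Fin n, c.initial = owners f ∧ IsClean L f := by
  have key : ∀ (g : Fin m) (l : List ℕ) (b : Fin n), (∀ a ∈ l, a < n) →
      -- The start value `b` is included in the claim because a liking agent found earlier becomes
      -- the start value of the remaining fold.
      ∃ j : Fin n, l.foldl (fun b i => if c.likes g i = true then i else b) (b : ℕ) = j ∧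
        (((∃ i : Fin n, (i : ℕ) ∈ l ∧ L g i) ∨ L g b) → L g j) := by
    intro g l
    induction l with
    | nil => exact fun b _ => ⟨b, rfl, by simp⟩
    | cons a l ih =>
      intro b hl
      have ha := hl a List.mem_cons_self
      have hlike := h.likes g ⟨a, ha⟩
      have ih := fun b => ih b fun x hx => hl x (List.mem_cons_of_mem _ hx)
      rw [List.foldl_cons]
      by_cases hL : L g ⟨a, ha⟩
      · rw [if_pos (hlike.2 hL)]
        obtain ⟨j, h1, h2⟩ := ih ⟨a, ha⟩
        exact ⟨j, h1, fun _ => h2 (Or.inr hL)⟩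
      · rw [if_neg (mt hlike.1 hL)]
        obtain ⟨j, h1, h2⟩ := ih b
        refine ⟨j, h1, fun h3 => h2 (h3.imp_left ?_)⟩
        rintro ⟨i, hi, hLi⟩
        refine ⟨i, (List.mem_cons.1 hi).resolve_left ?_, hLi⟩
        rintro rfl
        exact hL hLi
  choose f hf1 hf2 using fun g : Fin m => key g (List.range n) 0 fun a ha => List.mem_range.1 ha
  refine ⟨f, ?_, fun g i hi => hf2 g (Or.inl ⟨i, List.mem_range.2 i.2, hi⟩)⟩
  rw [initial, h.numItems, h.numAgents]
  refine owners_eq_map_range _ _ fun g => ?_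
  rw [← hf1 g]
  simp

theorem Represents.exists_search [NeZero n] (h : c.Represents L w) :
    ∃ f : Fin m → Fin n, c.search = owners f ∧ IsClean L f ∧ ∀ g i, ¬ IsViolation L w f g i := by
  obtain ⟨f, h1, h2⟩ := h.exists_initial
  have h3 : c.rounds.length = m * (m * n) := by
    simp [rounds, h.numItems, h.numAgents, List.length_flatMap]
  have h4 : potential L w f ≤ m * (m * n) := by
    refine (potential_le L w f).trans (le_of_eq ?_)
    simp only [Fintype.card_fin]
    ring
  have h5 := h.iterate_sweep _ f h2 h4
  rw [search, List.foldl_flatMap, h1, List.foldl_const (fun o => c.pairs.foldl c.move o), h3]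
  exact h5

theorem Represents.output_eq (h : c.Represents L w) (f : Fin m → Fin n) :
    c.output (owners f) = encodeAllocation (allocationOf f) := by
  rw [output, encodeAllocation, h.numItems, h.numAgents, ← List.map_coe_finRange_eq_range,
    ← List.map_coe_finRange_eq_range, List.flatMap_map]
  congr 1
  funext g
  rw [List.map_map, getD_owners]
  congr 2
  funext i
  simp only [Function.comp_apply, mem_allocationOf]
  by_cases e : f g = i
  · simp [e]
  · simp [e, Fin.val_inj]

end Table

/-! ### Parsing of the input -/

theorem bitsVal_encodeNat (k : ℕ) : bitsVal (encodeNat k) = k := by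
  have key : ∀ p : PosNum, bitsVal (encodePosNum p) = p := by
    intro p
    induction p with
    | one => rfl
    | bit1 p ih => rw [encodePosNum, bitsVal, ih, PosNum.cast_bit1]; simp; omega
    | bit0 p ih => rw [encodePosNum, bitsVal, ih, PosNum.cast_bit0]; simp; omega
  rw [encodeNat]
  have h : bitsVal (encodeNum (k : Num)) = ((k : Num) : ℕ) := by
    cases (k : Num) with
    | zero => rfl
    | pos p => exact key p
  rw [h, Num.to_of_nat]

theorem foldl_parseStep_encodeNumber (k : ℕ) (row rows) :
    (encodeNumber k).foldl parseStep ([], row, rows) = ([], encodeNat k :: row, rows) := by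
  have key : ∀ (l : List Bool) (cur : List Bool),
      (l.map inclusionBoolΓ').foldl parseStep (cur, row, rows) = (l.reverse ++ cur, row, rows) := by
    intro l
    induction l with
    | nil => simp
    | cons b l ih =>
      intro cur
      rw [List.map_cons, List.foldl_cons]
      have : parseStep (cur, row, rows) (inclusionBoolΓ' b) = (b :: cur, row, rows) := by
        cases b <;> rfl
      rw [this, ih]
      simp
  rw [encodeNumber, List.foldl_append]
  change List.foldl _ (List.foldl _ _ ((encodeNat k).map inclusionBoolΓ')) _ = _
  rw [key, List.append_nil]
  change ([], (encodeNat k).reverse.reverse :: row, rows) = _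
  rw [List.reverse_reverse]

theorem foldl_parseStep_row (l : List ℕ) : ∀ row rows,
    (l.flatMap encodeNumber ++ [Γ'.ket]).foldl parseStep ([], row, rows) =
      ([], [], (row.reverse ++ l.map encodeNat) :: rows) := by
  induction l with
  | nil => intro row rows; rw [List.map_nil, List.append_nil]; rfl
  | cons k l ih =>
    intro row rows
    rw [List.flatMap_cons, List.append_assoc, List.foldl_append, foldl_parseStep_encodeNumber, ih]
    simp

theorem parse_encodeInput (x : Input) :
    parse (encodeInput x) =
      ((List.finRange x.numAgents).flatMap fun i =>
        [encodeNat (x.weight i).num.natAbs, encodeNat (x.weight i).den],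
       (List.finRange x.numItems).map fun g => (List.finRange x.numAgents).flatMap fun i =>
        [encodeNat (x.inst.val i g), encodeNat (x.inst.impact i g)]) := by
  have pairs : ∀ (a b : Fin x.numAgents → ℕ), ((List.finRange x.numAgents).flatMap fun i =>
      encodeNumber (a i) ++ encodeNumber (b i)) =
      ((List.finRange x.numAgents).flatMap fun i => [a i, b i]).flatMap encodeNumber := by
    intro a b
    rw [List.flatMap_assoc]
    simp
  have rows : ∀ (l : List (Fin x.numItems)) (rows : List (List (List Bool))),
      (l.flatMap fun g => ((List.finRange x.numAgents).flatMap fun i =>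
        encodeNumber (x.inst.val i g) ++ encodeNumber (x.inst.impact i g)) ++ [Γ'.ket]).foldl
        parseStep ([], [], rows) =
      ([], [], (l.map fun g => (List.finRange x.numAgents).flatMap fun i =>
        [encodeNat (x.inst.val i g), encodeNat (x.inst.impact i g)]).reverse ++ rows) := by
    intro l
    induction l with
    | nil => simp
    | cons g l ih =>
      intro rows
      rw [List.flatMap_cons, List.foldl_append, pairs, foldl_parseStep_row, ih]
      simp [List.map_flatMap]
  have h : (encodeInput x).foldl parseStep ([], [], []) = ([], [],
      ((List.finRange x.numItems).map fun g => (List.finRange x.numAgents).flatMap fun i =>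
        [encodeNat (x.inst.val i g), encodeNat (x.inst.impact i g)]).reverse ++
      [(List.finRange x.numAgents).flatMap fun i =>
        [encodeNat (x.weight i).num.natAbs, encodeNat (x.weight i).den]]) := by
    rw [encodeInput, List.foldl_append]
    have h1 := foldl_parseStep_row ((List.finRange x.numAgents).flatMap fun i =>
      [(x.weight i).num.natAbs, (x.weight i).den]) [] []
    rw [← pairs, List.map_flatMap] at h1
    simp only [encodePosRat]
    rw [h1, rows]
    simp
  rw [parse, h]
  simp

theorem getElem?_flatMap_pair {α β : Type} (a b : α → β) {l : List α} : ∀ {i : ℕ} {x : α},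
    l[i]? = some x → (l.flatMap fun x => [a x, b x])[i + i]? = some (a x) ∧
      (l.flatMap fun x => [a x, b x])[i + i + 1]? = some (b x) := by
  induction l with
  | nil => simp
  | cons y l ih =>
    intro i x h
    cases i with
    | zero =>
      simp only [List.getElem?_cons_zero, Option.some.injEq] at h
      subst h
      simp
    | succ i =>
      have := ih (by simpa using h)
      rw [show i + 1 + (i + 1) = i + i + 1 + 1 by omega]
      simpa using this

theorem numAgents_flatMap_pair {n : ℕ} (a b : Fin n → List Bool) (r) :
    Table.numAgents ((List.finRange n).flatMap fun i => [a i, b i], r) = n := by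
  have key : ∀ (l : List (Fin n)) (k : ℕ), (l.flatMap fun i => [a i, b i]).foldl
      (fun (s : Bool × ℕ) _ => if s.1 = true then (false, s.2 + 1) else (true, s.2)) (false, k) =
      (false, k + l.length) := by
    intro l
    induction l with
    | nil => simp
    | cons i l ih => intro k; simp [ih]; omega
  rw [Table.numAgents, key]
  simp

/-- The weights are left general to cover both the given weights and the replacement of all of them
by 1. -/
theorem represents_of_pairs (x : Input) (a b : Fin x.numAgents → List Bool)
    (ha : ∀ i, 0 < bitsVal (a i)) (hb : ∀ i, 0 < bitsVal (b i)) {w : Fin x.numAgents → ℝ}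
    (hw : ∀ i, w i = (bitsVal (a i) : ℝ) / bitsVal (b i)) :
    Table.Represents ((List.finRange x.numAgents).flatMap fun i => [a i, b i],
       (List.finRange x.numItems).map fun g => (List.finRange x.numAgents).flatMap fun i =>
        [encodeNat (x.inst.val i g), encodeNat (x.inst.impact i g)]) (Likes x.inst) w := by
  have h0 : ∀ {k : ℕ} (i : Fin k), (List.finRange k)[(i : ℕ)]? = some i := fun i => by simp
  have h1 : ∀ i : Fin x.numAgents, Table.num ((List.finRange x.numAgents).flatMap fun i =>
      [a i, b i], (List.finRange x.numItems).map fun g => (List.finRange x.numAgents).flatMap fun i =>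
        [encodeNat (x.inst.val i g), encodeNat (x.inst.impact i g)]) i = a i := fun i => by
    rw [Table.num, List.getD_eq_getElem?_getD, (getElem?_flatMap_pair a b (h0 i)).1]
    rfl
  have h2 : ∀ i : Fin x.numAgents, Table.den ((List.finRange x.numAgents).flatMap fun i =>
      [a i, b i], (List.finRange x.numItems).map fun g => (List.finRange x.numAgents).flatMap fun i =>
        [encodeNat (x.inst.val i g), encodeNat (x.inst.impact i g)]) i = b i := fun i => by
    rw [Table.den, List.getD_eq_getElem?_getD, (getElem?_flatMap_pair a b (h0 i)).2]
    rfl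
  refine ⟨by simp [Table.numItems], numAgents_flatMap_pair a b _, fun g i => ?_,
    fun i => by rw [h1]; exact ha i, fun i => by rw [h2]; exact hb i,
    fun i => by rw [h1, h2]; exact hw i⟩
  rw [Table.likes, List.getD_eq_getElem?_getD, List.getD_eq_getElem?_getD, List.getElem?_map, h0,
    Option.map_some, Option.getD_some, (getElem?_flatMap_pair _ _ (h0 i)).1, Option.getD_some,
    Likes]
  have h3 := bitsVal_encodeNat (x.inst.val i g)
  -- The binary code of a number is empty exactly for 0, which is why `Table.likes` only tests for
  -- emptiness.
  rcases h : encodeNat (x.inst.val i g) with _ | ⟨_, l⟩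
  · rw [h] at h3
    rw [← h3]
    simp [bitsVal]
  · simp only [List.isEmpty_cons, Bool.not_false, true_iff]
    by_contra h4
    have h5 : x.inst.val i g = 0 := by omega
    rw [h5] at h
    exact absurd h (by simp [encodeNat, encodeNum])

theorem represents_parse (b : Bool) (x : Input) :
    (setWeights b (parse (encodeInput x))).Represents (Likes x.inst)
      (if b = true then fun i => (x.weight i : ℝ) else fun _ => 1) := by
  rw [parse_encodeInput]
  cases b
  · have h := represents_of_pairs x (fun _ => [true]) (fun _ => [true]) (fun _ => by simp [bitsVal])
      (fun _ => by simp [bitsVal]) (w := fun _ => 1) (fun _ => by simp [bitsVal])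
    simpa [setWeights, List.map_flatMap] using h
  · have hn : ∀ i, 0 < (x.weight i).num := fun i => Rat.num_pos.2 (x.weight_pos i)
    refine represents_of_pairs x _ _ (fun i => ?_) (fun i => ?_) (fun i => ?_)
    · rw [bitsVal_encodeNat]
      exact Int.natAbs_pos.2 (hn i).ne'
    · rw [bitsVal_encodeNat]
      exact (x.weight i).pos
    · rw [bitsVal_encodeNat, bitsVal_encodeNat]
      simp only [if_true]
      rw [Rat.cast_def, ← Int.cast_natCast (x.weight i).num.natAbs, Int.natAbs_of_nonneg (hn i).le]

theorem exists_solve (b : Bool) (x : Input) :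
    ∃ f : Fin x.numItems → Fin x.numAgents,
      solve b (encodeInput x) = encodeAllocation (allocationOf f) ∧ IsClean (Likes x.inst) f ∧
      ∀ g i, ¬ IsViolation (Likes x.inst)
        (if b = true then fun i => (x.weight i : ℝ) else fun _ => 1) f g i := by
  have : NeZero x.numAgents := ⟨x.numAgents_pos.ne'⟩
  have h := represents_parse b x
  obtain ⟨f, h1, h2⟩ := h.exists_search
  exact ⟨f, by rw [solve, h1, h.output_eq], h2⟩

/-- The algorithm finds fair allocations that maximize the social impact in polynomial time. -/
theorem exists_polyTime_alg (F : FairnessNotion) :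
    ∃ alg : ∀ x : BinaryEqualInput, Allocation (Fin x.1.numAgents) (Fin x.1.numItems),
      (∀ x : BinaryEqualInput, IsSIM x.1.inst (alg x) ∧
        IsFair F x.1.inst (fun i => (x.1.weight i : ℝ)) (alg x)) ∧ RunsInPolyTime alg := by
  -- The allocation is obtained by choice, but its encoding is the word `solve` computes, and only
  -- this word matters for the running time.
  choose f hf1 hf2 hf3 using fun x : BinaryEqualInput => exists_solve F.isWeighted x.1
  refine ⟨fun x => allocationOf (f x), fun x => ⟨isSIM_allocationOf x.2.1 x.2.2 (hf2 x), ?_⟩,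
    (PolyTime.solve F.isWeighted).computableInPolyTime _ _ fun x => (hf1 x).symm⟩
  have : NeZero x.1.numItems := ⟨x.1.numItems_pos.ne'⟩
  exact isFair_allocationOf F x.2.1 (fun i => Rat.cast_pos.2 (x.1.weight_pos i)) (hf2 x) (hf3 x)

end FairDivision

theorem mainTheorem3 (F : FairDivision.FairnessNotion) :
    (∀ (N : Type*) (M : Type*) [Fintype N] [Nonempty N] [Fintype M] [Nonempty M] [DecidableEq M]
        (I : FairDivision.SocialImpactInstance N M) (w : N → ℝ),
        (∀ i, 0 < w i) → I.IsBinary → I.ValEqImpact →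
        ∃ A : FairDivision.Allocation N M,
          FairDivision.IsSIM I A ∧ FairDivision.IsFair F I w A) ∧
    (∃ alg : ∀ x : FairDivision.BinaryEqualInput,
          FairDivision.Allocation (Fin x.1.numAgents) (Fin x.1.numItems),
        (∀ x : FairDivision.BinaryEqualInput,
          FairDivision.IsSIM x.1.inst (alg x) ∧
            FairDivision.IsFair F x.1.inst (fun i => (x.1.weight i : ℝ)) (alg x)) ∧
        FairDivision.RunsInPolyTime alg) := by
  exact ⟨fun N M _ _ _ _ _ I w hw hb he => FairDivision.exists_isSIM_isFair F I w hw hb he,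
    FairDivision.exists_polyTime_alg F⟩
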